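/- For a simple graph $X$ and a positive integer $m$, let $mX$ be the multigraph on the vertices of $X$ with $m$ distinct edges $\{x,y\}_0,\dots,\{x,y\}_{m-1}$ for each edge $\{x,y\}$ of $X$, and correspondingly $m$ arcs $(x,y)_0,\dots,(x,y)_{m-1}$ for each arc $(x,y)$ of $X$. Let $K(mX)$ be the simple graph whose vertices are the arcs of $mX$, in which any two distinct arcs emanating from the same vertex are adjacent, $(x,y)_i$ is adjacent to $(y,x)_i$ for every edge $\{x,y\}_i$ of $mX$, and there are no other edges. A Hamilton decomposition of a $k$-valent graph is a set of $\lfloor k/2\rfloor$ pairwise edge-disjoint Hamilton cycles in it. Consider the following connected $3$-valent arc-transitive graphs, each denoted by $F$ followed by its order (with a letter when there are several of that order): $F8$, the $3$-cube graph; $F10$, the Petersen graph; $F16$, the Möbius–Kantor graph; $F18$, the Pappus graph; $F20B$, the Desargues graph; $F24$, the Nauru graph; $F28$, the Coxeter graph; $F30$, the Tutte–Coxeter graph; $F32$, the Dyck graph; $F40$, the bipartite double cover of the dodecahedron graph; $F48$, the generalized Petersen graph $GP(24,5)$; $F50$, the toroidal hexagonal graph $\{6,3\}_{5,0}$ (that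 is, the graph with vertices $(a,\varepsilon)$, $a\in\mathbb Z_5^2$, $\varepsilon\in\{0,1\}$, in which $(a,0)$ is adjacent to $(a,1)$, $(a+(1,0),1)$ and $(a+(0,1),1)$). Then the twelve graphs $K(2F8)$, $K(2F10)$, $K(2F16)$, $K(2F18)$, $K(2F20B)$, $K(2F24)$, $K(2F28)$, $K(2F30)$, $K(2F32)$, $K(2F40)$, $K(2F48)$ and $K(2F50)$ are connected $6$-valent vertex-transitive graphs that have no Hamilton decomposition. -/

import Mathlib

namespace SimpleGraph

/-- The graph `K(mX)`.  Its vertices are the arcs `(x, y)_i` of the multigraph `mX`, which has `m`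
arcs `(x, y)_0, …, (x, y)_{m-1}` for each arc `(x, y)` of `X`; such an arc is represented by a pair
consisting of a dart of `X` and an index `i : Fin m`.  Two distinct arcs are adjacent when they
emanate from the same vertex; moreover `(x, y)_i` is adjacent to `(y, x)_i`. -/
def arcGraph {V : Type*} (m : ℕ) (X : SimpleGraph V) : SimpleGraph (X.Dart × Fin m) where
  Adj a b := a ≠ b ∧ (a.1.fst = b.1.fst ∨ (b.1 = a.1.symm ∧ b.2 = a.2))
  symm := ⟨by
    rintro a b ⟨hne, h | ⟨h1, h2⟩⟩
    · exact ⟨hne.symm, Or.inl h.symm⟩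
    · exact ⟨hne.symm, Or.inr ⟨by rw [h1, Dart.symm_symm], h2.symm⟩⟩⟩
  loopless := ⟨fun _ h => h.1 rfl⟩

instance {V : Type*} [DecidableEq V] (m : ℕ) (X : SimpleGraph V) :
    DecidableRel (arcGraph m X).Adj :=
  fun a b => inferInstanceAs
    (Decidable (a ≠ b ∧ (a.1.fst = b.1.fst ∨ (b.1 = a.1.symm ∧ b.2 = a.2))))

/-- A graph is vertex-transitive if its automorphism group acts transitively on its vertices. -/
def IsVertexTransitive {V : Type*} (G : SimpleGraph V) : Prop :=
  ∀ u v : V, ∃ φ : G ≃g G, φ u = v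

/-- A subgraph is a Hamilton cycle if it is the subgraph traced out by a closed walk which is a
Hamiltonian cycle. -/
def Subgraph.IsHamiltonCycle {V : Type*} [DecidableEq V] {G : SimpleGraph V}
    (Y : G.Subgraph) : Prop :=
  ∃ (v : V) (p : G.Walk v v), p.IsHamiltonianCycle ∧ p.toSubgraph = Y

/-- A `k`-valent graph has a Hamilton decomposition if it has a set of `⌊k / 2⌋` pairwise
edge-disjoint Hamilton cycles. -/
def HasHamiltonDecomposition {V : Type*} [DecidableEq V] (G : SimpleGraph V) [G.LocallyFinite] :
    Prop :=
  ∃ k : ℕ, G.IsRegularOfDegree k ∧ ∃ D : Finset G.Subgraph, D.card = k / 2 ∧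
    (∀ Y ∈ D, Y.IsHamiltonCycle) ∧
    ∀ Y ∈ D, ∀ Z ∈ D, Y ≠ Z → Disjoint Y.edgeSet Z.edgeSet

/-- The graph is connected, `6`-valent, vertex-transitive, and has no Hamilton decomposition. -/
def IsSixValentCounterexample {V : Type*} [DecidableEq V] (G : SimpleGraph V) [G.LocallyFinite] :
    Prop :=
  G.Connected ∧ G.IsRegularOfDegree 6 ∧ G.IsVertexTransitive ∧ ¬ G.HasHamiltonDecomposition

/-- The generalized Petersen graph `GP(n, k)`: an outer cycle on the vertices `(i, false)`, spokes
from `(i, false)` to `(i, true)`, and inner edges from `(i, true)` to `(i + k, true)`. -/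
def generalizedPetersen (n k : ℕ) : SimpleGraph (ZMod n × Bool) :=
  fromRel fun u v =>
    (u.2 = false ∧ v.2 = false ∧ v.1 = u.1 + 1) ∨
    (u.2 = false ∧ v.2 = true ∧ v.1 = u.1) ∨
    (u.2 = true ∧ v.2 = true ∧ v.1 = u.1 + k)

instance (n k : ℕ) : DecidableRel (generalizedPetersen n k).Adj :=
  fun u v => inferInstanceAs (Decidable ((fromRel _).Adj u v))

/-- The toroidal hexagonal graph `{6, 3}_{n, 0}`: the quotient of the hexagonal lattice by `n`
times its translation lattice.  It is bipartite of order `2 n ^ 2`. -/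
def hexagonalTorus (n : ℕ) : SimpleGraph ((ZMod n × ZMod n) × Bool) :=
  fromRel fun u v => u.2 = false ∧ v.2 = true ∧
    (v.1 = u.1 ∨ v.1 = u.1 + (1, 0) ∨ v.1 = u.1 + (0, 1))

instance (n : ℕ) : DecidableRel (hexagonalTorus n).Adj :=
  fun u v => inferInstanceAs (Decidable ((fromRel _).Adj u v))

/-- `F8`: the `3`-cube graph. -/
def F8 : SimpleGraph (Fin 3 → Bool) :=
  fromRel fun x y => hammingDist x y = 1

instance : DecidableRel F8.Adj :=
  fun u v => inferInstanceAs (Decidable ((fromRel _).Adj u v))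

/-- `F10`: the Petersen graph, on the `2`-subsets of a `5`-set, adjacent when disjoint. -/
def F10 : SimpleGraph ↥(Finset.powersetCard 2 (Finset.univ : Finset (Fin 5))) :=
  fromRel fun s t => Disjoint s.1 t.1

instance : DecidableRel F10.Adj :=
  fun u v => inferInstanceAs (Decidable ((fromRel _).Adj u v))

/-- `F16`: the Möbius–Kantor graph. -/
abbrev F16 := generalizedPetersen 8 3

/-- `F18`: the Pappus graph. -/
abbrev F18 := hexagonalTorus 3

/-- `F20B`: the Desargues graph. -/
abbrev F20B := generalizedPetersen 10 3

/-- `F24`: the Nauru graph. -/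
abbrev F24 := generalizedPetersen 12 5

/-- The lines `{i, i + 1, i + 3}` of the Fano plane on the point set `ZMod 7`. -/
def fanoLines : Finset (Finset (ZMod 7)) :=
  Finset.univ.image fun i => {i, i + 1, i + 3}

/-- `F28`: the Coxeter graph, on the `3`-subsets of the points of the Fano plane which are not
lines, adjacent when disjoint. -/
def F28 : SimpleGraph
    ↥((Finset.powersetCard 3 (Finset.univ : Finset (ZMod 7))).filter (· ∉ fanoLines)) :=
  fromRel fun s t => Disjoint s.1 t.1

instance : DecidableRel F28.Adj :=
  fun u v => inferInstanceAs (Decidable ((fromRel _).Adj u v))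

/-- The `15` duads (`2`-subsets) of a `6`-set. -/
def duads : Finset (Finset (Fin 6)) := Finset.powersetCard 2 Finset.univ

/-- The `15` synthemes of a `6`-set, that is, its partitions into three duads. -/
def synthemes : Finset (Finset (Finset (Fin 6))) :=
  (Finset.powersetCard 3 duads).filter fun s => s.biUnion id = Finset.univ

instance : DecidableEq ↥duads := fun a b => decidable_of_iff (a.1 = b.1) Subtype.ext_iff.symm

instance : DecidableEq ↥synthemes := fun a b => decidable_of_iff (a.1 = b.1) Subtype.ext_iff.symm

/-- `F30`: the Tutte–Coxeter graph, the incidence graph of duads and synthemes. -/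
def F30 : SimpleGraph (↥duads ⊕ ↥synthemes) :=
  fromRel fun u v => match u, v with
    | Sum.inl d, Sum.inr s => d.1 ∈ s.1
    | _, _ => False

instance : DecidableRel F30.Adj
  | Sum.inl d, Sum.inr s => decidable_of_iff (d.1 ∈ s.1) (by simp [F30])
  | Sum.inr s, Sum.inl d => decidable_of_iff (d.1 ∈ s.1) (by simp [F30])
  | Sum.inl _, Sum.inl _ => isFalse (by simp [F30])
  | Sum.inr _, Sum.inr _ => isFalse (by simp [F30])

/-- `F32`: the Dyck graph. -/
abbrev F32 := hexagonalTorus 4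

/-- `F40`: the bipartite double cover of the dodecahedron graph `GP(10, 2)`. -/
abbrev F40 := (generalizedPetersen 10 2).bipartiteDoubleCover

/-- `F48`: the generalized Petersen graph `GP(24, 5)`. -/
abbrev F48 := generalizedPetersen 24 5

/-- `F50`: the toroidal hexagonal graph `{6, 3}_{5, 0}`. -/
abbrev F50 := hexagonalTorus 5

end SimpleGraph

/-! In `K(2X)` with `X` cubic, each vertex `x` of `X` becomes a clique on the six arcs emanating
from it, and each arc has one further edge, to its opposite arc. A Hamilton decomposition consists
of three edge-disjoint Hamilton cycles. Each of them leaves each clique through a positive even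
number of the six outgoing edges, hence through exactly two, so every outgoing edge lies on exactly
one cycle. Contracting the cliques colours the edges of `2X` with three colours, each colour class
being connected, spanning and 2-valent. Two parallel edges cannot share a colour, since they would
form a component with only two vertices. Giving each edge of `X` the colour absent from its two
copies yields a proper 3-edge-colouring in which any two colours together form a Hamilton cycle: a
perfect colouring (`HasHamiltonDecomposition.exists_isPerfectColoring`). It remains to show that `X`
has none.

If `X` is bipartite with classes of even size, this is a parity argument
(`not_isPerfectColoring_of_even`). The colours are bijections `f₀`, `f₁`, `f₂` between the classes;
for `i ≠ j` the permutation `fⱼ⁻¹ fᵢ` is a single cycle of even length, so it is odd. But `f₂⁻¹ f₀`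
is the product of `f₂⁻¹ f₁` and `f₁⁻¹ f₀`, hence even. This settles F8, F16, F20B, F24, F32, F40 and
F48.

F10 and F28 are not bipartite, and F18, F30 and F50 have classes of odd size. For these a verified
backtracking search (`not_isPerfectColoring_of_colorSearchFrom`) colours the edges one by one and
prunes a branch when two edges of a colour meet or a two-coloured cycle closes. All listed edges
avoid a fixed vertex `z`, so a closed cycle is never spanning.

Vertex-transitivity of `K(2X)` comes from arc-transitivity of `X` together with the interchange of
the two indices. For each graph, arc-transitivity is certified by two explicit automorphisms: one
rotating the neighbours of a vertex, one moving that vertex to a neighbour. -/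

namespace SimpleGraph

/-! ### Perfect colourings, Hamilton cycles and parity of cuts. -/

section PerfectColoring

variable {V : Type*}

/-- A perfect `3`-colouring of the edges of `X`: edges with a common end have different colours, and
the edges of any two colours form a connected spanning subgraph. Colours are placed on darts, the
two darts of an edge having the same colour. -/
structure IsPerfectColoring (X : SimpleGraph V) (c : X.Dart → Fin 3) : Prop where
  symm : ∀ d, c d.symm = c d
  proper : ∀ d d', d.fst = d'.fst → c d = c d' → d = d'
  eq_univ : ∀ (i : Fin 3) (S : Set V), S.Nonempty →
    (∀ d : X.Dart, d.fst ∈ S → c d ≠ i → d.snd ∈ S) → S = Set.univ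

theorem Preconnected.eq_univ_of_forall_adj {G : SimpleGraph V} (hG : G.Preconnected) {S : Set V}
    (hS : S.Nonempty) (h : ∀ x ∈ S, ∀ y, G.Adj x y → y ∈ S) : S = Set.univ := by
  obtain ⟨x, hx⟩ := hS
  refine Set.eq_univ_of_forall fun y => ?_
  have := (reachable_iff_reflTransGen x y).1 (hG x y)
  induction this with
  | refl => exact hx
  | tail _ hbc ih => exact h _ ih _ hbc

/-- A Hamilton cycle is a connected spanning subgraph in which all vertices have valency `2`. -/
theorem Subgraph.IsHamiltonCycle.connected_and_ncard [DecidableEq V] {G : SimpleGraph V}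
    {Y : G.Subgraph} (hY : Y.IsHamiltonCycle) :
    Y.spanningCoe.Preconnected ∧ ∀ v, (Y.spanningCoe.neighborSet v).ncard = 2 := by
  obtain ⟨v, p, hp, rfl⟩ := hY
  have hspan : p.toSubgraph.IsSpanning := fun w =>
    (Walk.mem_verts_toSubgraph p).2 (hp.mem_support w)
  constructor
  · have := p.toSubgraph_connected
    exact ((Subgraph.spanningCoeEquivCoeOfSpanning _ hspan).connected_iff.2 this.coe).preconnected
  · intro w
    exact hp.isCycle.ncard_neighborSet_toSubgraph_eq_two (hp.mem_support w)

/-- In any graph, the valencies inside a set of vertices add up to an even number. -/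
theorem even_sum_card_filter_adj {W : Type*} [Fintype W] [DecidableEq W] (H : SimpleGraph W)
    [DecidableRel H.Adj] (A : Finset W) : Even (∑ a ∈ A, (A.filter (H.Adj a)).card) := by
  classical
  let H' : SimpleGraph W :=
    { Adj := fun a b => H.Adj a b ∧ a ∈ A ∧ b ∈ A
      symm := ⟨fun a b h => ⟨h.1.symm, h.2.2, h.2.1⟩⟩
      loopless := ⟨fun a h => H.loopless.irrefl a h.1⟩ }
  have key : ∑ a ∈ A, (A.filter (H.Adj a)).card = ∑ a, H'.degree a := by
    rw [← Finset.sum_subset (Finset.subset_univ A)]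
    · refine Finset.sum_congr rfl fun a ha => ?_
      rw [← card_neighborFinset_eq_degree]
      congr 1
      ext b
      simp [H', ha, and_comm]
    · intro a _ ha
      rw [← card_neighborFinset_eq_degree, Finset.card_eq_zero]
      ext b
      simp [H', ha]
  rw [key, sum_degrees_eq_twice_card_edges]
  exact even_two_mul _

/-- If every vertex in `A` has two neighbours, of which at most one, `f a`, is outside `A`, then
an even number of edges leave `A`. -/
theorem even_card_filter_adj {W : Type*} [Fintype W] [DecidableEq W] (H : SimpleGraph W)
    [DecidableRel H.Adj] (A : Finset W) (f : W → W) (hdeg : ∀ a, (H.neighborSet a).ncard = 2)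
    (hf : ∀ a ∈ A, f a ∉ A) (hA : ∀ a ∈ A, ∀ b, H.Adj a b → b ∈ A ∨ b = f a) :
    Even (A.filter fun a => H.Adj a (f a)).card := by
  -- Summing this over `A` gives `2|A|`; the valencies inside `A` have an even sum by the handshake
  -- lemma, so the number of outgoing edges is even.
  have h1 : ∀ a ∈ A, (A.filter (H.Adj a)).card + (if H.Adj a (f a) then 1 else 0) = 2 := by
    intro a ha
    have h2 : H.neighborSet a = ↑(A.filter (H.Adj a) ∪ if H.Adj a (f a) then {f a} else ∅) := by
      ext b
      simp only [mem_neighborSet, Finset.coe_union, Finset.coe_filter, Set.mem_union,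
        Set.mem_ofPred_eq]
      constructor
      · intro hb
        rcases hA a ha b hb with h | rfl
        · exact Or.inl ⟨h, hb⟩
        · right; simp [hb]
      · rintro (h | h)
        · exact h.2
        · split_ifs at h with hh
          · simp at h; exact h ▸ hh
          · simp at h
    rw [← hdeg a, h2, Set.ncard_coe_finset, Finset.card_union_of_disjoint]
    · congr 1
      split_ifs <;> simp
    · split_ifs
      · simp [hf a ha]
      · simp
  have h3 := Finset.sum_congr rfl h1
  rw [Finset.sum_add_distrib, ← Finset.card_filter] at h3
  have h4 := even_sum_card_filter_adj H A
  have h5 : Even (∑ a ∈ A, 2) := by simp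
  rw [← h3] at h5
  exact (Nat.even_add.1 h5).1 h4

/-! ### From Hamilton decompositions of `K(2X)` to perfect colourings of `X`. -/

section Reduction

/-- The arc `(y, x)_i` opposite to the arc `(x, y)_i`. -/
def arcFlip {X : SimpleGraph V} (a : X.Dart × Fin 2) : X.Dart × Fin 2 := (a.1.symm, a.2)

theorem arcFlip_arcFlip {X : SimpleGraph V} (a : X.Dart × Fin 2) : arcFlip (arcFlip a) = a := by
  simp [arcFlip]

variable [Fintype V] [DecidableEq V] {X : SimpleGraph V} [DecidableRel X.Adj]

/-- The arcs emanating from `x`. -/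
def arcsFrom (X : SimpleGraph V) [DecidableRel X.Adj] (x : V) : Finset (X.Dart × Fin 2) :=
  Finset.univ.filter fun a => a.1.fst = x

theorem mem_arcsFrom {x : V} {a : X.Dart × Fin 2} : a ∈ arcsFrom X x ↔ a.1.fst = x := by
  simp [arcsFrom]

theorem card_arcsFrom (hX : X.IsRegularOfDegree 3) (x : V) : (arcsFrom X x).card = 6 := by
  have h : arcsFrom X x = (Finset.univ.filter fun d : X.Dart => d.toProd.1 = x) ×ˢ Finset.univ := by
    ext a; simp [arcsFrom]
  rw [h, Finset.card_product, dart_fst_fiber_card_eq_degree, hX.degree_eq]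
  simp

theorem card_darts_fst (hX : X.IsRegularOfDegree 3) (x : V) :
    (Finset.univ.filter fun d : X.Dart => d.fst = x).card = 3 := by
  rw [← hX.degree_eq x]; exact dart_fst_fiber_card_eq_degree X x

theorem arcFlip_notMem_arcsFrom {x : V} {a : X.Dart × Fin 2} (ha : a ∈ arcsFrom X x) :
    arcFlip a ∉ arcsFrom X x := by
  rw [mem_arcsFrom] at *
  intro h
  exact a.1.fst_ne_snd (ha.trans h.symm)

/-- A labelling of the arcs of `2X` by `3` colours, two arcs of each colour emanating from each
vertex, such that each colour forms a connected subgraph. -/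
structure IsArcLabeling (X : SimpleGraph V) [DecidableRel X.Adj] (h : X.Dart × Fin 2 → Fin 3) :
    Prop where
  flip : ∀ a, h (arcFlip a) = h a
  card : ∀ x i, ((arcsFrom X x).filter fun a => h a = i).card = 2
  eq_univ : ∀ (i : Fin 3) (S : Set V), S.Nonempty →
    (∀ a : X.Dart × Fin 2, a.1.fst ∈ S → h a = i → a.1.snd ∈ S) → S = Set.univ

/-- The matching edges in three edge-disjoint Hamilton cycles of `K(2X)` label the arcs of `2X`. -/
theorem exists_isArcLabeling (hX : X.IsRegularOfDegree 3) [Nontrivial V]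
    (H : Fin 3 → SimpleGraph (X.Dart × Fin 2)) (hle : ∀ i, H i ≤ arcGraph 2 X)
    (hdisj : ∀ i j a b, (H i).Adj a b → (H j).Adj a b → i = j)
    (hconn : ∀ i, (H i).Preconnected) (hdeg : ∀ i a, ((H i).neighborSet a).ncard = 2) :
    ∃ h, IsArcLabeling X h := by
  classical
  have hA : ∀ i a b, (H i).Adj a b → b.1.fst = a.1.fst ∨ b = arcFlip a := by
    intro i a b hab
    obtain ⟨-, h | h⟩ := hle i hab
    · exact Or.inl h.symm
    · exact Or.inr (Prod.ext h.1 h.2)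
  have hne : ∀ x, (arcsFrom X x).Nonempty := fun x => by
    rw [← Finset.card_pos, card_arcsFrom hX]; norm_num
  -- Connectivity survives contraction of the cliques: the union of the cliques over `S` is closed
  -- under `H i`.
  have hcross : ∀ i (S : Set V), S.Nonempty →
      (∀ a : X.Dart × Fin 2, a.1.fst ∈ S → (H i).Adj a (arcFlip a) → a.1.snd ∈ S) →
      S = Set.univ := by
    intro i S ⟨x, hx⟩ hS
    obtain ⟨a, ha⟩ := hne x
    rw [mem_arcsFrom] at ha
    have := (hconn i).eq_univ_of_forall_adj (S := {a | a.1.fst ∈ S}) ⟨a, by simpa [ha] using hx⟩ (by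
      intro a ha b hab
      rcases hA i a b hab with h | rfl
      · simpa [h] using ha
      · exact hS a ha hab)
    refine Set.eq_univ_of_forall fun y => ?_
    obtain ⟨b, hb⟩ := hne y
    rw [mem_arcsFrom] at hb
    have : b ∈ {a : X.Dart × Fin 2 | a.1.fst ∈ S} := this ▸ Set.mem_univ b
    simpa [hb] using this
  have hcard : ∀ x i, 2 ≤ ((arcsFrom X x).filter fun a => (H i).Adj a (arcFlip a)).card := by
    intro x i
    have heven := even_card_filter_adj (H i) (arcsFrom X x) arcFlip (hdeg i)
      (fun a ha => arcFlip_notMem_arcsFrom ha) (fun a ha b hab => by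
        rw [mem_arcsFrom] at *
        rcases hA i a b hab with h | h
        · exact Or.inl (h.trans ha)
        · exact Or.inr h)
    -- If cycle `i` had no edge leaving the clique at `x`, then `{x}` would be closed, although `V`
    -- has another vertex.
    have hpos : 0 < ((arcsFrom X x).filter fun a => (H i).Adj a (arcFlip a)).card := by
      rw [Finset.card_pos]
      by_contra hcon
      rw [Finset.not_nonempty_iff_eq_empty, Finset.filter_eq_empty_iff] at hcon
      have := hcross i {x} ⟨x, rfl⟩ (fun a ha hadj => absurd hadj (hcon (mem_arcsFrom.2 ha)))
      obtain ⟨y, hy⟩ := exists_ne x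
      exact hy (Set.mem_singleton_iff.1 (this.symm.subset (Set.mem_univ y)))
    obtain ⟨k, hk⟩ := heven
    omega
  have hdis : ∀ x, ((Finset.univ : Finset (Fin 3)) : Set (Fin 3)).PairwiseDisjoint
      fun i => (arcsFrom X x).filter fun a => (H i).Adj a (arcFlip a) := by
    intro x i _ j _ hij
    rw [Function.onFun, Finset.disjoint_left]
    intro a hi hj
    exact hij (hdisj i j _ _ (Finset.mem_filter.1 hi).2 (Finset.mem_filter.1 hj).2)
  have hsub : ∀ x, (Finset.univ.biUnion fun i =>
      (arcsFrom X x).filter fun a => (H i).Adj a (arcFlip a)) ⊆ arcsFrom X x := by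
    intro x
    simp [Finset.biUnion_subset_iff_forall_subset]
  have hsum : ∀ x, ∑ i, ((arcsFrom X x).filter fun a => (H i).Adj a (arcFlip a)).card ≤ 6 := by
    intro x
    rw [← Finset.card_biUnion (hdis x), ← card_arcsFrom hX x]
    exact Finset.card_le_card (hsub x)
  -- Three numbers, each at least 2, with sum at most 6.
  have hcard2 : ∀ x i, ((arcsFrom X x).filter fun a => (H i).Adj a (arcFlip a)).card = 2 := by
    intro x i
    have h0 := hcard x 0
    have h1 := hcard x 1
    have h2 := hcard x 2
    have := hsum x
    rw [Fin.sum_univ_three] at this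
    fin_cases i <;> simp only [Fin.zero_eta, Fin.mk_one, Fin.reduceFinMk] <;> omega
  have hex : ∀ a, ∃ i, (H i).Adj a (arcFlip a) := by
    intro a
    -- The three disjoint pairs exhaust the six arcs, so each outgoing edge belongs to some cycle.
    have h : (Finset.univ.biUnion fun i =>
        (arcsFrom X a.1.fst).filter fun a => (H i).Adj a (arcFlip a)) = arcsFrom X a.1.fst := by
      refine Finset.eq_of_subset_of_card_le (hsub _) ?_
      rw [Finset.card_biUnion (hdis _), card_arcsFrom hX, Fin.sum_univ_three, hcard2, hcard2,
        hcard2]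
    have ha : a ∈ arcsFrom X a.1.fst := mem_arcsFrom.2 rfl
    rw [← h] at ha
    simp only [Finset.mem_biUnion, Finset.mem_filter] at ha
    obtain ⟨i, -, -, hi⟩ := ha
    exact ⟨i, hi⟩
  choose h hh using hex
  have hiff : ∀ a i, h a = i ↔ (H i).Adj a (arcFlip a) := fun a i =>
    ⟨fun e => e ▸ hh a, fun e => hdisj _ _ _ _ (hh a) e⟩
  refine ⟨h, fun a => ?_, fun x i => ?_, fun i S hS hS' => ?_⟩
  · rw [hiff, arcFlip_arcFlip]
    exact (hh a).symm
  · simp only [hiff, hcard2]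
  · exact hcross i S hS fun a ha hadj => hS' a ha ((hiff a i).2 hadj)

/-- Two equally coloured copies of an edge use up that colour at both ends. Its ends would then be a
whole component of the colour, but a cubic graph has at least four vertices. -/
theorem IsArcLabeling.ne (hX : X.IsRegularOfDegree 3) {h : X.Dart × Fin 2 → Fin 3}
    (hh : IsArcLabeling X h) (d : X.Dart) : h (d, 0) ≠ h (d, 1) := by
  intro heq
  have key : ∀ (d : X.Dart), h (d, 0) = h (d, 1) → ∀ a : X.Dart × Fin 2, a.1.fst = d.fst →
      h a = h (d, 0) → a.1 = d := by
    intro d heq a ha hi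
    have hs : {(d, 0), (d, 1)} ⊆ (arcsFrom X d.fst).filter fun a => h a = h (d, 0) := by
      intro b hb
      simp only [Finset.mem_insert, Finset.mem_singleton] at hb
      rcases hb with rfl | rfl <;> simp [mem_arcsFrom, heq]
    have := Finset.eq_of_subset_of_card_le hs (by rw [hh.card]; simp)
    have ha' : a ∈ (arcsFrom X d.fst).filter fun a => h a = h (d, 0) := by
      simp [mem_arcsFrom, ha, hi]
    rw [← this] at ha'
    simp only [Finset.mem_insert, Finset.mem_singleton] at ha'
    rcases ha' with rfl | rfl <;> rfl
  have hu := hh.eq_univ (h (d, 0)) {d.fst, d.snd} ⟨_, Or.inl rfl⟩ (by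
    intro a ha hi
    have h0 : h (d.symm, 0) = h (d, 0) := hh.flip (d, 0)
    have h1 : h (d.symm, 1) = h (d, 1) := hh.flip (d, 1)
    rcases ha with ha | ha
    · rw [key d heq a ha hi]; exact Or.inr rfl
    · rw [key d.symm (by rw [h0, h1, heq]) a ha (by rw [h0, hi])]; exact Or.inl rfl)
  have h4 : X.degree d.fst < Fintype.card V := X.degree_lt_card_verts d.fst
  rw [hX.degree_eq] at h4
  have h5 : (Set.univ : Set V).ncard ≤ 2 := hu ▸ (Set.ncard_insert_le _ _).trans (by simp)
  rw [Set.ncard_univ, Nat.card_eq_fintype_card] at h5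
  omega

/-- The colour of an edge of `X` is the one missing from its two copies in `2X`. The edges avoiding
colour `i` are therefore those having a copy labelled `i`, and they form a connected graph. -/
theorem IsArcLabeling.exists_isPerfectColoring (hX : X.IsRegularOfDegree 3)
    {h : X.Dart × Fin 2 → Fin 3} (hh : IsArcLabeling X h) : ∃ c, IsPerfectColoring X c := by
  have hthird : ∀ i j : Fin 3, i ≠ j → ∃ k, ∀ l, l = k ↔ l ≠ i ∧ l ≠ j := by decide
  choose c hc using fun d => hthird _ _ (hh.ne hX d)
  refine ⟨c, fun d => ?_, fun d d' hfst hdd => ?_, fun i S hS hS' => ?_⟩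
  · have h0 : h (d.symm, 0) = h (d, 0) := hh.flip (d, 0)
    have h1 : h (d.symm, 1) = h (d, 1) := hh.flip (d, 1)
    rw [hc, ← h0, ← h1, ← hc]
  · by_contra hne
    have hcd := (hc d _).1 rfl
    have hcd' := (hc d' _).1 hdd
    -- If `d` and `d'` both lack the colour `c d`, the two arcs of that colour at their common
    -- origin lie on other darts, and on different ones by `IsArcLabeling.ne`. That makes four darts
    -- at a vertex of valency 3.
    have hnot : ∀ a : X.Dart × Fin 2, h a = c d → a.1 ≠ d ∧ a.1 ≠ d' := by
      rintro ⟨e, j⟩ ha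
      constructor <;> rintro rfl <;> fin_cases j
      · exact hcd.1 ha.symm
      · exact hcd.2 ha.symm
      · exact hcd'.1 ha.symm
      · exact hcd'.2 ha.symm
    obtain ⟨a, b, hab, hs⟩ := Finset.card_eq_two.1 (hh.card d.fst (c d))
    have ha : a ∈ (arcsFrom X d.fst).filter fun a => h a = c d := by rw [hs]; simp
    have hb : b ∈ (arcsFrom X d.fst).filter fun a => h a = c d := by rw [hs]; simp
    simp only [Finset.mem_filter, mem_arcsFrom] at ha hb
    by_cases h1 : a.1 = b.1
    · obtain ⟨e, j⟩ := a
      obtain ⟨e', j'⟩ := b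
      obtain rfl : e = e' := h1
      have hj : h (e, 0) = h (e, 1) := by
        have := ha.2.trans hb.2.symm
        fin_cases j <;> fin_cases j'
        · exact absurd rfl hab
        · exact this
        · exact this.symm
        · exact absurd rfl hab
      exact hh.ne hX e hj
    · have hfour : ({d, d', a.1, b.1} : Finset X.Dart).card = 4 := by
        rw [Finset.card_insert_of_notMem, Finset.card_insert_of_notMem,
          Finset.card_insert_of_notMem, Finset.card_singleton]
        · simpa using h1
        · simpa using ⟨(hnot a ha.2).2.symm, (hnot b hb.2).2.symm⟩
        · simpa using ⟨hne, (hnot a ha.2).1.symm, (hnot b hb.2).1.symm⟩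
      have hle := Finset.card_le_card (s := ({d, d', a.1, b.1} : Finset X.Dart))
        (t := Finset.univ.filter fun e : X.Dart => e.fst = d.fst) (by
          intro e he
          simp only [Finset.mem_insert, Finset.mem_singleton] at he
          simp only [Finset.mem_filter, Finset.mem_univ, true_and]
          rcases he with rfl | rfl | rfl | rfl
          · rfl
          · exact hfst.symm
          · exact ha.1
          · exact hb.1)
      rw [hfour, card_darts_fst hX] at hle
      omega
  · refine hh.eq_univ i S hS fun a ha hi => hS' a.1 ha ?_
    intro hci
    have := (hc a.1 _).1 hci.symm
    obtain ⟨d, j⟩ := a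
    fin_cases j
    · exact this.1 hi.symm
    · exact this.2 hi.symm

/-- A Hamilton decomposition of `K(2X)` gives a perfect `3`-colouring of the edges of `X`. -/
theorem HasHamiltonDecomposition.exists_isPerfectColoring [DecidableEq (X.Dart × Fin 2)]
    [(arcGraph 2 X).LocallyFinite] (hX : X.IsRegularOfDegree 3) [Nontrivial V]
    (h6 : (arcGraph 2 X).IsRegularOfDegree 6) (h : (arcGraph 2 X).HasHamiltonDecomposition) :
    ∃ c, IsPerfectColoring X c := by
  obtain ⟨k, hk, D, hD, hham, hdisj⟩ := h
  obtain ⟨x⟩ : Nonempty V := inferInstance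
  obtain ⟨a, -⟩ : (arcsFrom X x).Nonempty := by
    rw [← Finset.card_pos, card_arcsFrom hX]; norm_num
  obtain rfl : k = 6 := (hk a).symm.trans (h6 a)
  let e := (D.equivFinOfCardEq hD).symm
  obtain ⟨h, hh⟩ := exists_isArcLabeling hX (fun i => (e i).1.spanningCoe)
    (fun i => Subgraph.spanningCoe_le _)
    (by
      intro i j a b hi hj
      by_contra hne
      have hne' : (e i).1 ≠ (e j).1 := fun h => hne (e.injective (Subtype.ext h))
      have := hdisj _ (e i).2 _ (e j).2 hne'
      rw [Set.disjoint_left] at this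
      exact this (a := s(a, b)) hi hj)
    (fun i => (hham _ (e i).2).connected_and_ncard.1)
    (fun i => (hham _ (e i).2).connected_and_ncard.2)
  exact hh.exists_isPerfectColoring hX

end Reduction

end PerfectColoring

/-! ### Arc-transitivity of `X`; symmetry, connectedness and valency of `K(mX)`. -/

section Symmetry

variable {V : Type*} {X : SimpleGraph V}

/-- A graph is arc-transitive if its automorphism group acts transitively on its arcs. -/
def IsArcTransitive (X : SimpleGraph V) : Prop :=
  ∀ d d' : X.Dart, ∃ φ : X ≃g X, φ d.fst = d'.fst ∧ φ d.snd = d'.snd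

/-- A connected graph is arc-transitive as soon as some arc `(v, w)` can be mapped to every arc
emanating from `v`, and to some arc emanating from `w`. -/
theorem Connected.isArcTransitive (hX : X.Connected) {v w : V} (τ : X ≃g X) (hτ : τ v = w)
    (hv : ∀ u, X.Adj v u → ∃ φ : X ≃g X, φ v = v ∧ φ w = u) : X.IsArcTransitive := by
  have hvert : ∀ y, ∃ φ : X ≃g X, φ v = y := by
    intro y
    have := (reachable_iff_reflTransGen v y).1 (hX.preconnected v y)
    induction this with
    | refl => exact ⟨Iso.refl, rfl⟩
    | @tail b y _ hby ih =>
      obtain ⟨φ, rfl⟩ := ih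
      -- With `b = φ v`, the automorphism `φ ∘ ψ ∘ τ` sends `v` to `w`, then to `φ⁻¹ y`, then to
      -- `y`.
      obtain ⟨ψ, -, hψ⟩ := hv (φ.symm y) (by rw [← φ.map_adj_iff]; simpa using hby)
      refine ⟨(τ.trans ψ).trans φ, ?_⟩
      simp [hτ, hψ]
  have harc : ∀ d : X.Dart, ∃ φ : X ≃g X, φ v = d.fst ∧ φ w = d.snd := by
    intro d
    obtain ⟨φ, hφ⟩ := hvert d.fst
    obtain ⟨ψ, h1, h2⟩ := hv (φ.symm d.snd) (by
      rw [← φ.map_adj_iff, hφ]; simp)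
    exact ⟨ψ.trans φ, by simp [h1, hφ], by simp [h2]⟩
  intro d d'
  obtain ⟨φ, h1, h2⟩ := harc d
  obtain ⟨ψ, h3, h4⟩ := harc d'
  exact ⟨φ.symm.trans ψ, by simp [← h1, ← h3], by simp [← h2, ← h4]⟩

theorem IsArcTransitive.of_iso {W : Type*} {Y : SimpleGraph W} (e : X ≃g Y)
    (hY : Y.IsArcTransitive) : X.IsArcTransitive := by
  intro d d'
  obtain ⟨φ, h1, h2⟩ := hY (e.toHom.mapDart d) (e.toHom.mapDart d')
  refine ⟨(e.trans φ).trans e.symm, ?_, ?_⟩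
  · change e.symm (φ (e d.fst)) = _
    rw [show φ (e d.fst) = e d'.fst from h1, RelIso.symm_apply_apply]
  · change e.symm (φ (e d.snd)) = _
    rw [show φ (e d.snd) = e d'.snd from h2, RelIso.symm_apply_apply]

theorem IsPerfectColoring.of_iso {W : Type*} {Y : SimpleGraph W} (e : X ≃g Y)
    {c : X.Dart → Fin 3} (hc : IsPerfectColoring X c) :
    IsPerfectColoring Y fun d => c (e.symm.toHom.mapDart d) := by
  refine ⟨fun d => hc.symm (e.symm.toHom.mapDart d), fun d d' h h' => ?_, fun i S ⟨y, hy⟩ hS => ?_⟩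
  · have := hc.proper (e.symm.toHom.mapDart d) (e.symm.toHom.mapDart d') (congrArg e.symm h) h'
    ext
    · exact h
    · exact e.symm.injective (congrArg (fun d : X.Dart => d.snd) this)
  · have := hc.eq_univ i (e ⁻¹' S) ⟨e.symm y, by simpa using hy⟩ fun d hd hi => by
      refine hS (e.toHom.mapDart d) hd ?_
      convert hi using 2
      ext
      · exact e.symm_apply_apply _
      · exact e.symm_apply_apply _
    refine Set.eq_univ_of_forall fun z => ?_
    have : e.symm z ∈ e ⁻¹' S := this ▸ Set.mem_univ _
    simpa using this

/-- The automorphism of `K(mX)` induced by an automorphism of `X` and a permutation of the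
indices. -/
def arcGraphIso (m : ℕ) (φ : X ≃g X) (σ : Equiv.Perm (Fin m)) : arcGraph m X ≃g arcGraph m X where
  toFun a := (φ.toHom.mapDart a.1, σ a.2)
  invFun a := (φ.symm.toHom.mapDart a.1, σ.symm a.2)
  left_inv a := by
    refine Prod.ext ?_ (by simp)
    ext
    · exact φ.symm_apply_apply _
    · exact φ.symm_apply_apply _
  right_inv a := by
    refine Prod.ext ?_ (by simp)
    ext
    · exact φ.apply_symm_apply _
    · exact φ.apply_symm_apply _
  map_rel_iff' := by
    rintro ⟨a, i⟩ ⟨b, j⟩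
    have h1 : ∀ a b : X.Dart, φ.toHom.mapDart a = φ.toHom.mapDart b ↔ a = b := by
      refine fun a b => ⟨fun h => ?_, fun h => h ▸ rfl⟩
      ext
      · exact φ.injective (congrArg (fun d : X.Dart => d.fst) h)
      · exact φ.injective (congrArg (fun d : X.Dart => d.snd) h)
    have h2 : (φ.toHom.mapDart a).fst = (φ.toHom.mapDart b).fst ↔ a.fst = b.fst :=
      φ.injective.eq_iff
    have h3 : φ.toHom.mapDart b = (φ.toHom.mapDart a).symm ↔ b = a.symm := h1 b a.symm
    change (φ.toHom.mapDart a, σ i) ≠ (φ.toHom.mapDart b, σ j) ∧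
      ((φ.toHom.mapDart a).fst = (φ.toHom.mapDart b).fst ∨
      φ.toHom.mapDart b = (φ.toHom.mapDart a).symm ∧ σ j = σ i) ↔
      (a, i) ≠ (b, j) ∧ (a.fst = b.fst ∨ b = a.symm ∧ j = i)
    rw [ne_eq, ne_eq, Prod.mk.injEq, Prod.mk.injEq, h1, h2, h3, σ.injective.eq_iff,
      σ.injective.eq_iff]

/-- An automorphism of `X` moves the underlying arc, and a transposition of the indices moves the
index. -/
theorem IsArcTransitive.isVertexTransitive_arcGraph (hX : X.IsArcTransitive) (m : ℕ) :
    (arcGraph m X).IsVertexTransitive := by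
  intro a b
  obtain ⟨φ, h1, h2⟩ := hX a.1 b.1
  refine ⟨arcGraphIso m φ (Equiv.swap a.2 b.2), Prod.ext ?_ (Equiv.swap_apply_left _ _)⟩
  ext
  · exact h1
  · exact h2

theorem connected_arcGraph (hX : X.Connected) [Nontrivial V] {m : ℕ} (hm : 0 < m) :
    (arcGraph m X).Connected := by
  have hfst : ∀ a b : X.Dart × Fin m, a.1.fst = b.1.fst → (arcGraph m X).Reachable a b := by
    intro a b h
    by_cases hab : a = b
    · exact hab ▸ Reachable.refl _
    · exact Adj.reachable ⟨hab, Or.inl h⟩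
  have hdart : ∀ x, ∃ d : X.Dart, d.fst = x := fun x => by
    obtain ⟨y, hy⟩ := hX.preconnected.exists_adj_of_nontrivial x
    exact ⟨⟨(x, y), hy⟩, rfl⟩
  have hpre : (arcGraph m X).Preconnected := by
    intro a b
    have key : ∀ y, Relation.ReflTransGen X.Adj a.1.fst y →
        ∀ b : X.Dart × Fin m, b.1.fst = y → (arcGraph m X).Reachable a b := by
      intro y hy
      induction hy with
      | refl => exact fun b hb => hfst a b hb.symm
      | @tail x y _ hxy ih =>
        intro b hb
        refine (ih (⟨(x, y), hxy⟩, b.2) rfl).trans (Reachable.trans (v := (⟨(y, x), hxy.symm⟩, b.2))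
          (Adj.reachable ⟨fun h => ?_, Or.inr ⟨rfl, rfl⟩⟩) (hfst _ b hb.symm))
        exact hxy.ne (congrArg (fun a => a.1.fst) h)
    exact key _ ((reachable_iff_reflTransGen _ _).1 (hX.preconnected _ _)) b rfl
  obtain ⟨x⟩ : Nonempty V := inferInstance
  obtain ⟨d, -⟩ := hdart x
  exact (connected_iff _).2 ⟨hpre, ⟨d, ⟨0, hm⟩⟩⟩

theorem isRegularOfDegree_arcGraph [Fintype V] [DecidableEq V] [DecidableRel X.Adj]
    [(arcGraph 2 X).LocallyFinite] (hX : X.IsRegularOfDegree 3) :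
    (arcGraph 2 X).IsRegularOfDegree 6 := by
  intro a
  have h : (arcGraph 2 X).neighborFinset a =
      insert (arcFlip a) ((arcsFrom X a.1.fst).erase a) := by
    ext b
    simp only [mem_neighborFinset, Finset.mem_insert, Finset.mem_erase, mem_arcsFrom]
    constructor
    · rintro ⟨hne, h | h⟩
      · exact Or.inr ⟨hne.symm, h.symm⟩
      · exact Or.inl (Prod.ext h.1 h.2)
    · rintro (rfl | ⟨hne, h⟩)
      · refine ⟨fun h => ?_, Or.inr ⟨rfl, rfl⟩⟩
        exact a.1.fst_ne_snd (congrArg (fun a => a.1.fst) h)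
      · exact ⟨hne.symm, Or.inl h.symm⟩
  have ha : a ∈ arcsFrom X a.1.fst := mem_arcsFrom.2 rfl
  rw [← card_neighborFinset_eq_degree, h, Finset.card_insert_of_notMem, Finset.card_erase_of_mem ha,
    card_arcsFrom hX]
  exact fun h => arcFlip_notMem_arcsFrom ha (Finset.mem_of_mem_erase h)

theorem isSixValentCounterexample_arcGraph [Fintype V] [DecidableEq V] [DecidableRel X.Adj]
    [DecidableEq (X.Dart × Fin 2)] [(arcGraph 2 X).LocallyFinite] (hconn : X.Connected)
    (hreg : X.IsRegularOfDegree 3) (harc : X.IsArcTransitive)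
    (hcol : ∀ c, ¬ IsPerfectColoring X c) : (arcGraph 2 X).IsSixValentCounterexample := by
  obtain ⟨x⟩ := hconn.nonempty
  have : Nontrivial V := by
    have h := X.degree_lt_card_verts x
    rw [hreg.degree_eq] at h
    exact Fintype.one_lt_card_iff_nontrivial.1 (by omega)
  have h6 := isRegularOfDegree_arcGraph hreg
  refine ⟨connected_arcGraph hconn two_pos, h6, harc.isVertexTransitive_arcGraph 2, fun h => ?_⟩
  obtain ⟨c, hc⟩ := h.exists_isPerfectColoring hreg h6
  exact hcol c hc

end Symmetry

/-! ### The sign obstruction for bipartite graphs with classes of even size. -/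

section Parity

variable {V : Type*} {X : SimpleGraph V} {c : X.Dart → Fin 3}

/-- This allows the search to prescribe the colours 0 and 1 of two edges at a vertex. -/
theorem IsPerfectColoring.comp_perm (hc : IsPerfectColoring X c) (σ : Equiv.Perm (Fin 3)) :
    IsPerfectColoring X fun d => σ (c d) :=
  ⟨fun d => by rw [hc.symm], fun d d' h h' => hc.proper d d' h (σ.injective h'),
    fun i S hS hS' => hc.eq_univ (σ.symm i) S hS fun d hd hi =>
      hS' d hd fun h => hi (by rw [← h, Equiv.symm_apply_apply])⟩

/-- The permutation walks along an edge of colour `i` and back along one of colour `j`, which is two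
steps on the cycle formed by these colours. As that cycle is spanning, a single orbit covers the
class. -/
theorem IsPerfectColoring.sameCycle (hc : IsPerfectColoring X c)
    (s : V → Bool) (hs : ∀ x y, X.Adj x y → s x = !s y) {i j : Fin 3} (hij : i ≠ j)
    {f g : {x // s x = false} ≃ {x // s x = true}}
    (hf : ∀ d : X.Dart, c d = i →
      ∀ (h : s d.fst = false) (h' : s d.snd = true), f ⟨d.fst, h⟩ = ⟨d.snd, h'⟩)
    (hg : ∀ d : X.Dart, c d = j →
      ∀ (h : s d.fst = false) (h' : s d.snd = true), g ⟨d.fst, h⟩ = ⟨d.snd, h'⟩)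
    (x y : {x // s x = false}) : Equiv.Perm.SameCycle (f.trans g.symm) x y := by
  have hthird : ∀ i j : Fin 3, i ≠ j → ∃ k, ∀ l, l ≠ k → l = i ∨ l = j := by decide
  obtain ⟨k, hk⟩ := hthird i j hij
  have hS := hc.eq_univ k
    -- The orbit of `x` together with the mates of its members in colour `i`; this set is closed
    -- under all colours but `k`.
    {v | (∃ h : s v = false, Equiv.Perm.SameCycle (f.trans g.symm) x ⟨v, h⟩) ∨
      ∃ h : s v = true, Equiv.Perm.SameCycle (f.trans g.symm) x (f.symm ⟨v, h⟩)}
    ⟨x, Or.inl ⟨x.2, Equiv.Perm.SameCycle.refl _ _⟩⟩ (by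
      rintro d (⟨h, hd⟩ | ⟨h, hd⟩) hdk
      · have h' : s d.snd = true := by
          have := hs _ _ d.adj
          rw [h] at this
          simpa using this.symm
        refine Or.inr ⟨h', ?_⟩
        rcases hk _ hdk with hi | hj
        · rwa [← hf d hi h h', Equiv.symm_apply_apply]
        · refine Equiv.Perm.sameCycle_apply_right.1 ?_
          rwa [Equiv.trans_apply, Equiv.apply_symm_apply, ← hg d hj h h', Equiv.symm_apply_apply]
      · have h' : s d.snd = false := by
          have := hs _ _ d.adj
          rw [h] at this
          simpa using this.symm
        refine Or.inl ⟨h', ?_⟩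
        rcases hk _ hdk with hi | hj
        · rwa [← show f ⟨d.snd, h'⟩ = ⟨d.fst, h⟩ from
            hf d.symm ((hc.symm d).trans hi) h' h, Equiv.symm_apply_apply] at hd
        · have := Equiv.Perm.sameCycle_apply_right.2 hd
          rwa [Equiv.trans_apply, Equiv.apply_symm_apply, ← show g ⟨d.snd, h'⟩ = ⟨d.fst, h⟩ from
            hg d.symm ((hc.symm d).trans hj) h' h, Equiv.symm_apply_apply] at this)
  have hy : (y : V) ∈ {v | (∃ h : s v = false, Equiv.Perm.SameCycle (f.trans g.symm) x ⟨v, h⟩) ∨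
      ∃ h : s v = true, Equiv.Perm.SameCycle (f.trans g.symm) x (f.symm ⟨v, h⟩)} := hS ▸ Set.mem_univ _
  rcases hy with ⟨_, h⟩ | ⟨h, _⟩
  · exact h
  · rw [y.2] at h; exact absurd h (by simp)

variable [Fintype V] [DecidableEq V] [DecidableRel X.Adj]

theorem IsPerfectColoring.exists_dart (hc : IsPerfectColoring X c) (hX : X.IsRegularOfDegree 3)
    (x : V) (i : Fin 3) : ∃ d : X.Dart, d.fst = x ∧ c d = i := by
  have himg : (Finset.univ.filter fun d : X.Dart => d.fst = x).image c = Finset.univ := by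
    refine Finset.eq_univ_of_card _ ?_
    rw [Finset.card_image_of_injOn, card_darts_fst hX, Fintype.card_fin]
    intro d hd d' hd' h
    simp only [Finset.coe_filter, Finset.mem_univ, true_and, Set.mem_ofPred_eq] at hd hd'
    exact hc.proper d d' (hd.trans hd'.symm) h
  have hi : i ∈ (Finset.univ.filter fun d : X.Dart => d.fst = x).image c := himg ▸ Finset.mem_univ i
  obtain ⟨d, hd, rfl⟩ := Finset.mem_image.1 hi
  exact ⟨d, by simpa using hd, rfl⟩

/-- In a bipartite cubic graph, each colour of a perfect colouring matches the two classes. -/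
theorem IsPerfectColoring.exists_equiv (hc : IsPerfectColoring X c) (hX : X.IsRegularOfDegree 3)
    (s : V → Bool) (hs : ∀ x y, X.Adj x y → s x = !s y) (i : Fin 3) :
    ∃ f : {x // s x = false} ≃ {x // s x = true}, ∀ d : X.Dart, c d = i →
      ∀ (h : s d.fst = false) (h' : s d.snd = true), f ⟨d.fst, h⟩ = ⟨d.snd, h'⟩ := by
  choose D hD hDc using fun x => hc.exists_dart hX x i
  have hmate : ∀ d : X.Dart, c d = i → (D d.fst) = d := fun d hd =>
    hc.proper _ _ (hD _) ((hDc _).trans hd.symm)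
  have hinv : ∀ x, (D (D x).snd).snd = x := fun x => by
    rw [show D (D x).snd = (D x).symm from hmate (D x).symm ((hc.symm _).trans (hDc x))]
    exact hD x
  have hside : ∀ x, s x = !s (D x).snd := fun x => by
    have := hs _ _ (D x).adj
    rwa [hD] at this
  refine ⟨⟨fun x => ⟨(D x).snd, ?_⟩, fun x => ⟨(D x).snd, ?_⟩, fun x => ?_, fun x => ?_⟩, ?_⟩
  · have := hside x
    rw [x.2] at this
    simpa using this.symm
  · have := hside x
    rw [x.2] at this
    simpa using this.symm
  · exact Subtype.ext (hinv x)
  · exact Subtype.ext (hinv x)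
  · intro d hd h h'
    exact Subtype.ext (congrArg (fun d : X.Dart => d.snd) (hmate d hd))

theorem sign_eq_neg_one_of_sameCycle {α : Type*} [Fintype α] [DecidableEq α]
    (σ : Equiv.Perm α) (hσ : ∀ x y, σ.SameCycle x y) (h0 : 0 < Fintype.card α)
    (heven : Even (Fintype.card α)) : Equiv.Perm.sign σ = -1 := by
  have : Nontrivial α := by
    rw [← Fintype.one_lt_card_iff_nontrivial]
    obtain ⟨k, hk⟩ := heven
    omega
  have hon : σ.IsCycleOn Set.univ := ⟨Set.bijOn_univ.2 σ.bijective, fun x _ y _ => hσ x y⟩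
  have hcyc : σ.IsCycle := Equiv.Perm.isCycle_iff_exists_isCycleOn.2
    ⟨Set.univ, Set.nontrivial_univ, hon, fun x _ => Set.mem_univ x⟩
  have hsupp : σ.support = Finset.univ := by
    ext x
    simpa using hon.apply_ne Set.nontrivial_univ (Set.mem_univ x)
  rw [hcyc.sign, hsupp, Finset.card_univ, heven.neg_one_pow]

/-- A bipartite cubic graph with an even number of vertices in its classes has no perfect
`3`-colouring. -/
theorem not_isPerfectColoring_of_even (hX : X.IsRegularOfDegree 3) (s : V → Bool)
    (hs : ∀ x y, X.Adj x y → s x = !s y) (h0 : 0 < Fintype.card {x // s x = false})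
    (heven : Even (Fintype.card {x // s x = false})) (c : X.Dart → Fin 3) :
    ¬ IsPerfectColoring X c := by
  intro hc
  choose f hf using hc.exists_equiv hX s hs
  have hsign : ∀ i j, i ≠ j → Equiv.Perm.sign ((f i).trans (f j).symm) = -1 := fun i j hij =>
    sign_eq_neg_one_of_sameCycle _ (hc.sameCycle s hs hij (hf i) (hf j)) h0 heven
  -- Multiplicativity of the sign turns this identity into `-1 = (-1) * (-1)`.
  have hmul : (f 0).trans (f 2).symm =
      ((f 1).trans (f 2).symm : Equiv.Perm _) * ((f 0).trans (f 1).symm : Equiv.Perm _) := by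
    ext x
    simp
  have := hsign 0 2 (by decide)
  rw [hmul, Equiv.Perm.sign_mul, hsign 1 2 (by decide), hsign 0 1 (by decide)] at this
  exact absurd this (by decide)

end Parity

/-! ### Two-coloured paths in partial colourings, recorded by their ends. -/

section PathTable

/-- The ternary relation `E i u v` (`u` and `v` are joined by an edge of colour `i`) of a perfect
`3`-colouring of a graph with vertices `0, …, n - 1`. -/
structure IsPerfectRel (n : ℕ) (E : Fin 3 → ℕ → ℕ → Prop) : Prop where
  symm : ∀ {i u v}, E i u v → E i v u
  right_unique : ∀ {i u v w}, E i u v → E i u w → v = w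
  color_unique : ∀ {i j u v}, E i u v → E j u v → i = j
  mem_of_closed : ∀ {a b : Fin 3}, a ≠ b → ∀ S : Set ℕ, (∃ x ∈ S, x < n) →
    (∀ x ∈ S, ∀ y, E a x y ∨ E b x y → y ∈ S) → ∀ x < n, x ∈ S

variable {E : Fin 3 → ℕ → ℕ → Prop} {P : ℕ → ℕ → Prop} {a b : Fin 3} {u v n : ℕ} {L : ℕ → ℕ}

/-- Some edge of colour `i` at `x` is in the set `P` of edges. -/
def IsUsed (E : Fin 3 → ℕ → ℕ → Prop) (P : ℕ → ℕ → Prop) (i : Fin 3) (x : ℕ) : Prop :=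
  ∃ y, E i x y ∧ P x y

/-- The edges of `P`, and the edge `uv`. -/
def addEdge (P : ℕ → ℕ → Prop) (u v : ℕ) (x y : ℕ) : Prop :=
  P x y ∨ (x = u ∧ y = v) ∨ (x = v ∧ y = u)

/-- The edges of `P` with the colours `a` and `b` form disjoint paths and cycles. The table `L`
exchanges the two ends of every path; `S` is the set of vertices of the path ending in `x`. -/
def IsPathTable (E : Fin 3 → ℕ → ℕ → Prop) (P : ℕ → ℕ → Prop) (a b : Fin 3) (L : ℕ → ℕ) : Prop :=
  ∀ x < 64, ¬ (IsUsed E P a x ∧ IsUsed E P b x) → L x < 64 ∧ L (L x) = x ∧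
    ¬ (IsUsed E P a (L x) ∧ IsUsed E P b (L x)) ∧
    (L x = x → ¬ IsUsed E P a x ∧ ¬ IsUsed E P b x) ∧
    (L x ≠ x → IsUsed E P a x ∨ IsUsed E P b x) ∧
    ∃ S : Set ℕ, x ∈ S ∧ L x ∈ S ∧ (∀ y ∈ S, ∀ w, E a y w ∨ E b y w → P y w → w ∈ S) ∧
      ∀ y ∈ S, y ≠ x → y ≠ L x → IsUsed E P a y ∧ IsUsed E P b y

theorem IsPathTable.comm (h : IsPathTable E P a b L) : IsPathTable E P b a L := by
  intro x hx hf
  obtain ⟨h1, h2, h3, h4, h5, S, h6, h7, h8, h9⟩ := h x hx fun h => hf h.symm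
  exact ⟨h1, h2, fun h => h3 h.symm, fun h => (h4 h).symm, fun h => (h5 h).symm, S, h6, h7,
    fun y hy w hw => h8 y hy w hw.symm, fun y hy hx hL => (h9 y hy hx hL).symm⟩

theorem isPathTable_empty (hL : ∀ x < 64, L x = x) :
    IsPathTable E (fun _ _ => False) a b L := by
  intro x hx _
  rw [hL x hx, hL x hx]
  refine ⟨hx, rfl, ?_, ?_, fun h => absurd rfl h, {x}, rfl, rfl, ?_, ?_⟩ <;> simp [IsUsed]

theorem not_isUsed (hE : IsPerfectRel n E) (h : E a u v) (hP : ¬ P u v) : ¬ IsUsed E P a u := by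
  rintro ⟨y, hy, hPy⟩
  exact hP (hE.right_unique h hy ▸ hPy)

theorem isUsed_addEdge (hE : IsPerfectRel n E) (h : E a u v) (x : ℕ) :
    IsUsed E (addEdge P u v) a x ↔ IsUsed E P a x ∨ x = u ∨ x = v := by
  constructor
  · rintro ⟨y, hy, hP | ⟨rfl, rfl⟩ | ⟨rfl, rfl⟩⟩
    · exact Or.inl ⟨y, hy, hP⟩
    · exact Or.inr (Or.inl rfl)
    · exact Or.inr (Or.inr rfl)
  · rintro (⟨y, hy, hP⟩ | rfl | rfl)
    · exact ⟨y, hy, Or.inl hP⟩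
    · exact ⟨v, h, Or.inr (Or.inl ⟨rfl, rfl⟩)⟩
    · exact ⟨u, hE.symm h, Or.inr (Or.inr ⟨rfl, rfl⟩)⟩

theorem addEdge_iff_of_ne (hE : IsPerfectRel n E) (h : E a u v) (hb : b ≠ a) {x y : ℕ}
    (hxy : E b x y) : addEdge P u v x y ↔ P x y := by
  refine ⟨?_, Or.inl⟩
  rintro (hP | ⟨rfl, rfl⟩ | ⟨rfl, rfl⟩)
  · exact hP
  · exact absurd (hE.color_unique hxy h) hb
  · exact absurd (hE.color_unique (hE.symm hxy) h) hb

theorem isUsed_addEdge_of_ne (hE : IsPerfectRel n E) (h : E a u v) (hb : b ≠ a) (x : ℕ) :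
    IsUsed E (addEdge P u v) b x ↔ IsUsed E P b x :=
  exists_congr fun _ => and_congr_right fun hy => addEdge_iff_of_ne hE h hb hy

/-- An edge of a third colour belongs to no path in the colours `a` and `b`. -/
theorem IsPathTable.addEdge_of_ne (hE : IsPerfectRel n E) {c : Fin 3} (h : E c u v) (ha : a ≠ c)
    (hb : b ≠ c) (hL : IsPathTable E P a b L) : IsPathTable E (addEdge P u v) a b L := by
  intro x hx hf
  simp only [isUsed_addEdge_of_ne hE h ha, isUsed_addEdge_of_ne hE h hb] at hf ⊢
  obtain ⟨h1, h2, h3, h4, h5, S, h6, h7, h8, h9⟩ := hL x hx hf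
  refine ⟨h1, h2, h3, h4, h5, S, h6, h7, fun y hy w hw hP => h8 y hy w hw ?_, h9⟩
  rcases hw with hw | hw
  · exact (addEdge_iff_of_ne hE h ha hw).1 hP
  · exact (addEdge_iff_of_ne hE h hb hw).1 hP

/-- No edge joins the two ends of a path in two colours that avoids some vertex `z`. -/
theorem IsPathTable.ne_of_rel (hE : IsPerfectRel n E) (hL : IsPathTable E P a b L) (hab : a ≠ b)
    (hn : n ≤ 64) (hu : u < n) (h : E a u v) (hP : ¬ P u v) (hP' : ¬ P v u)
    (hne : u ≠ v) {z : ℕ} (hz : z < n) (hzP : ∀ y, ¬ P z y) (hzu : z ≠ u) (hzv : z ≠ v) :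
    L u ≠ v := by
  rintro rfl
  have hua := not_isUsed hE h hP
  have hva := not_isUsed hE (hE.symm h) hP'
  obtain ⟨h1, h2, h3, -, h5, S, h6, h7, h8, h9⟩ := hL u (by omega) fun h => hua h.1
  obtain ⟨-, -, -, -, h5', -⟩ := hL (L u) h1 h3
  have hub : IsUsed E P b u := (h5 hne.symm).resolve_left hua
  have hvb : IsUsed E P b (L u) := (h5' (by rw [h2]; exact hne)).resolve_left hva
  -- With the edge `uv`, the path from `u` to `v` closes into a cycle, so its vertex set `S` is
  -- closed under all edges of the two colours. Perfectness then forces `z ∈ S`, but no edge of `P`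
  -- meets `z`.
  have step : ∀ i, i = a ∨ i = b → ∀ x ∈ S, IsUsed E P i x → ∀ y, E i x y → y ∈ S := by
    rintro i hi x hx ⟨w, hw, hPw⟩ y hy
    rw [hE.right_unique hy hw]
    refine h8 x hx w ?_ hPw
    rcases hi with rfl | rfl
    · exact Or.inl hw
    · exact Or.inr hw
  have hzS : z ∈ S := by
    refine hE.mem_of_closed hab S ⟨u, h6, hu⟩ (fun x hx y hxy => ?_) z hz
    by_cases hxu : x = u
    · subst hxu
      rcases hxy with hxy | hxy
      · rwa [hE.right_unique hxy h]
      · exact step b (Or.inr rfl) x hx hub y hxy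
    by_cases hxv : x = L u
    · subst hxv
      rcases hxy with hxy | hxy
      · rwa [hE.right_unique hxy (hE.symm h)]
      · exact step b (Or.inr rfl) _ hx hvb y hxy
    · obtain ⟨hxa, hxb⟩ := h9 x hx hxu hxv
      rcases hxy with hxy | hxy
      · exact step a (Or.inl rfl) x hx hxa y hxy
      · exact step b (Or.inr rfl) x hx hxb y hxy
  obtain ⟨⟨y, -, hy⟩, -⟩ := h9 z hzS hzu hzv
  exact hzP y hy

/-- The table obtained when an edge joins the vertices `u` and `v`. -/
def joinTable (L : ℕ → ℕ) (u v x : ℕ) : ℕ :=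
  if x = L u then L v else if x = L v then L u else L x

/-- The edge `uv` joins two different paths, ending in `u` and `v`, into one path with ends `L u`
and `L v`; its vertex set is `S ∪ T`. Only the entries at these two ends need to change, because a
table is unconstrained at interior vertices, where both colours are used. An isolated vertex is a
path whose two ends coincide. -/
theorem IsPathTable.addEdge (hE : IsPerfectRel n E) (hL : IsPathTable E P a b L) (hab : a ≠ b)
    (hu : u < 64) (hv : v < 64) (h : E a u v) (hP : ¬ P u v) (hP' : ¬ P v u)
    (hne : u ≠ v) (hLu : L u ≠ v) : IsPathTable E (addEdge P u v) a b (joinTable L u v) := by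
  have hua := not_isUsed hE h hP
  have hva := not_isUsed hE (hE.symm h) hP'
  obtain ⟨u1, u2, u3, u4, u5, S, u6, u7, u8, u9⟩ := hL u hu fun h => hua h.1
  obtain ⟨v1, v2, v3, v4, v5, T, v6, v7, v8, v9⟩ := hL v hv fun h => hva h.1
  have hLv : L v ≠ u := fun h => hLu (by rw [← h, v2])
  have hLL : L u ≠ L v := fun h => hne (by rw [← u2, h, v2])
  have Ua := fun x => isUsed_addEdge (P := P) hE h x
  have Ub := fun x => isUsed_addEdge_of_ne (P := P) hE h hab.symm x
  have hJu : joinTable L u v (L u) = L v := if_pos rfl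
  have hJv : joinTable L u v (L v) = L u := by rw [joinTable, if_neg hLL.symm, if_pos rfl]
  have hclosed : ∀ y ∈ S ∪ T, ∀ w, E a y w ∨ E b y w → SimpleGraph.addEdge P u v y w →
      w ∈ S ∪ T := by
    rintro y hy w hw (hPw | ⟨rfl, rfl⟩ | ⟨rfl, rfl⟩)
    · rcases hy with hy | hy
      · exact Or.inl (u8 y hy w hw hPw)
      · exact Or.inr (v8 y hy w hw hPw)
    · exact Or.inr v6
    · exact Or.inl u6
  have hfull : ∀ y ∈ S ∪ T, y ≠ L u → y ≠ L v →
      IsUsed E (SimpleGraph.addEdge P u v) a y ∧ IsUsed E (SimpleGraph.addEdge P u v) b y := by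
    intro y hy hyu hyv
    rw [Ua, Ub]
    by_cases h1 : y = u
    · subst h1
      exact ⟨Or.inr (Or.inl rfl), (u5 hyu.symm).resolve_left hua⟩
    by_cases h2 : y = v
    · subst h2
      exact ⟨Or.inr (Or.inr rfl), (v5 hyv.symm).resolve_left hva⟩
    rcases hy with hy | hy
    · exact (u9 y hy h1 hyu).imp_left Or.inl
    · exact (v9 y hy h2 hyv).imp_left Or.inl
  have hend : ∀ {u v}, L (L u) = u → ¬ (IsUsed E P a (L u) ∧ IsUsed E P b (L u)) →
      (L u = u → ¬ IsUsed E P a u ∧ ¬ IsUsed E P b u) → L u ≠ v →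
      ¬ ((IsUsed E P a (L u) ∨ L u = u ∨ L u = v) ∧ IsUsed E P b (L u)) := by
    rintro u v u2 u3 u4 hLu ⟨h1 | h1 | h1, h2⟩
    · exact u3 ⟨h1, h2⟩
    · rw [h1] at h2; exact (u4 h1).2 h2
    · exact hLu h1
  have hused : ∀ {u v}, L u < 64 → L (L u) = u →
      ¬ (IsUsed E P a (L u) ∧ IsUsed E P b (L u)) →
      (IsUsed E P a (L u) ∨ L u = u ∨ L u = v) ∨ IsUsed E P b (L u) := by
    intro u v u1 u2 u3
    by_cases h1 : L u = u
    · exact Or.inl (Or.inr (Or.inl h1))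
    · rcases (hL (L u) u1 u3).2.2.2.2.1 (by rw [u2]; exact Ne.symm h1) with h | h
      · exact Or.inl (Or.inl h)
      · exact Or.inr h
  intro x hx hf
  by_cases hxu : x = L u
  · subst hxu
    rw [hJu, hJv, Ua, Ub, Ua, Ub]
    refine ⟨v1, rfl, ?_, fun h => absurd h.symm hLL, fun _ => hused u1 u2 u3, S ∪ T, Or.inl u7,
      Or.inr v7, hclosed, hfull⟩
    have := hend v2 v3 v4 hLv
    rwa [or_comm (a := L v = v)] at this
  by_cases hxv : x = L v
  · subst hxv
    rw [hJv, hJu, Ua, Ub, Ua, Ub]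
    refine ⟨u1, rfl, hend u2 u3 u4 hLu, fun h => absurd h hLL, fun _ => ?_, S ∪ T,
      Or.inr v7, Or.inl u7, hclosed, fun y hy h1 h2 => hfull y hy h2 h1⟩
    rw [or_comm (a := L v = u)]
    exact hused v1 v2 v3
  have hJx : joinTable L u v x = L x := by rw [joinTable, if_neg hxu, if_neg hxv]
  -- If `u` is not itself a new end, it was already used by colour `b`; the edge `uv` makes it
  -- interior.
  have hxu' : x ≠ u := by
    rintro rfl
    rw [Ua, Ub] at hf
    exact hf ⟨Or.inr (Or.inl rfl), (u5 (Ne.symm hxu)).resolve_left hua⟩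
  have hxv' : x ≠ v := by
    rintro rfl
    rw [Ua, Ub] at hf
    exact hf ⟨Or.inr (Or.inr rfl), (v5 (Ne.symm hxv)).resolve_left hva⟩
  rw [Ua, Ub] at hf
  obtain ⟨h1, h2, h3, h4, h5, R, h6, h7, h8, h9⟩ := hL x hx fun h => hf ⟨Or.inl h.1, h.2⟩
  have hLxu : L x ≠ u := fun h => hxu (by rw [← h, h2])
  have hLxv : L x ≠ v := fun h => hxv (by rw [← h, h2])
  have hLxu' : L x ≠ L u := fun h => hxu' (by rw [← h2, h, u2])
  have hLxv' : L x ≠ L v := fun h => hxv' (by rw [← h2, h, v2])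
  have hJLx : joinTable L u v (L x) = L (L x) := by rw [joinTable, if_neg hLxu', if_neg hLxv']
  rw [hJx, hJLx, Ua, Ub, Ua, Ub]
  refine ⟨h1, h2, ?_, fun h => ?_, fun h => ?_, R, h6, h7, ?_, fun y hy hyx hyL => ?_⟩
  · rintro ⟨h | h | h, hb⟩
    · exact h3 ⟨h, hb⟩
    · exact hLxu h
    · exact hLxv h
  · exact ⟨by simp [hxu', hxv', (h4 h).1], (h4 h).2⟩
  · exact (h5 h).imp_left Or.inl
  · rintro y hy w hw (hPw | ⟨rfl, rfl⟩ | ⟨rfl, rfl⟩)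
    · exact h8 y hy w hw hPw
    · exact absurd (h9 y hy (Ne.symm hxu') (Ne.symm hLxu)).1 hua
    · exact absurd (h9 y hy (Ne.symm hxv') (Ne.symm hLxv)).1 hva
  · rw [Ua, Ub]
    exact (h9 y hy hyx hyL).imp_left Or.inl

end PathTable

/-! ### The backtracking search and its soundness. -/

section Search

/-- `withValue x f` is `f x`; the kernel evaluates `x` before it passes it to `f`. -/
def withValue (x : ℕ) (f : ℕ → Bool) : Bool :=
  Nat.rec (motive := fun _ => Bool) (f 0) (fun n _ => f n.succ) x

theorem withValue_eq (x : ℕ) (f : ℕ → Bool) : withValue x f = f x := by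
  cases x <;> rfl

/-- The entry with index `u` of a table of numbers less than `64`, stored in base `64`. -/
def tableEntry (t u : ℕ) : ℕ := (t >>> (6 * u)) % 64

/-- Change the entries `u` and `v` with indices `u'` and `v'` to `v'` and `u'`. -/
def tableJoin (t u v u' v' : ℕ) : ℕ :=
  (t ^^^ ((v' ^^^ u) <<< (6 * u'))) ^^^ ((u' ^^^ v) <<< (6 * v'))

/-- The table of the identity map. -/
def tableId : ℕ := Nat.rec (motive := fun _ => ℕ) 0 (fun i t => t + i * 64 ^ i) 64

theorem tableEntry_tableId : ∀ x < 64, tableEntry tableId x = x := by decide +kernel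

theorem tableEntry_lt (t u : ℕ) : tableEntry t u < 64 := Nat.mod_lt _ (by norm_num)

theorem tableEntry_xor (t d k x : ℕ) (hd : d < 64) :
    tableEntry (t ^^^ (d <<< (6 * k))) x = tableEntry t x ^^^ if x = k then d else 0 := by
  have h64 : (64 : ℕ) = 2 ^ 6 := by norm_num
  apply Nat.eq_of_testBit_eq
  intro i
  unfold tableEntry
  rw [h64] at hd ⊢
  have hbit : ∀ j, 6 ≤ j → d.testBit j = false := fun j hj =>
    Nat.testBit_lt_two_pow (hd.trans_le (Nat.pow_le_pow_right (by norm_num) hj))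
  rw [Nat.testBit_mod_two_pow, Nat.testBit_xor, Nat.testBit_mod_two_pow, Nat.testBit_shiftRight,
    Nat.testBit_shiftRight, Nat.testBit_xor, Nat.testBit_shiftLeft]
  by_cases hi : i < 6
  · rcases lt_trichotomy x k with h | rfl | h
    · rw [if_neg h.ne]
      have : ¬ 6 * x + i ≥ 6 * k := by omega
      simp [this]
    · simp [hi]
    · rw [if_neg h.ne', hbit _ (by omega)]
      simp
  · split_ifs
    · simp [hi, hbit i (by omega)]
    · simp [hi]

/-- The entry at index `L u` is `u` by the involution property, so XOR with `L v ^^^ u` replaces it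
by `L v`; likewise at index `L v`. -/
theorem tableEntry_tableJoin {t u v : ℕ} (hu : u < 64) (hv : v < 64)
    (htu : tableEntry t (tableEntry t u) = u) (htv : tableEntry t (tableEntry t v) = v)
    (hne : u ≠ v) : tableEntry (tableJoin t u v (tableEntry t u) (tableEntry t v)) =
      joinTable (tableEntry t) u v := by
  have hxor : ∀ {x y : ℕ}, x < 64 → y < 64 → x ^^^ y < 64 := fun hx hy =>
    Nat.xor_lt_two_pow (n := 6) hx hy
  ext x
  have hne' : tableEntry t u ≠ tableEntry t v := fun h => hne (by rw [← htu, h, htv])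
  rw [tableJoin, tableEntry_xor _ _ _ _ (hxor (tableEntry_lt _ _) hv),
    tableEntry_xor _ _ _ _ (hxor (tableEntry_lt _ _) hu), joinTable]
  by_cases h1 : x = tableEntry t u
  · rw [if_pos h1, if_pos h1, if_neg (fun h => hne' (h1.symm.trans h)), h1, htu, Nat.xor_zero,
      Nat.xor_comm, Nat.xor_assoc, Nat.xor_self, Nat.xor_zero]
  · rw [if_neg h1, if_neg h1, Nat.xor_zero]
    by_cases h2 : x = tableEntry t v
    · rw [if_pos h2, if_pos h2, h2, htv, Nat.xor_comm, Nat.xor_assoc, Nat.xor_self, Nat.xor_zero]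
    · rw [if_neg h2, if_neg h2, Nat.xor_zero]

/-- Try to give the edge `uv` a colour, where `m` is the set of the ends of the edges of this
colour, and `s` and `t` are the path tables for this and another colour. The result is `true` if
this is impossible or `k` is `true` for the new values. -/
def tryColor (u v m s t : ℕ) (k : ℕ → ℕ → ℕ → Bool) : Bool :=
  withValue (2 ^ u ||| 2 ^ v) fun e => cond (Nat.beq (m &&& e) 0)
    (withValue (tableEntry s u) fun x => cond (Nat.beq x v) true <|
      withValue (tableEntry t u) fun x' => cond (Nat.beq x' v) true <|
        withValue (tableEntry s v) fun y => withValue (tableEntry t v) fun y' =>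
          withValue (m ||| e) fun m => withValue (tableJoin s u v x y) fun s =>
            withValue (tableJoin t u v x' y') fun t => k m s t)
    true

/-- Once the three reasons for rejecting the colour are excluded, the answer `true` can only come
from the continuation `k`. -/
theorem tryColor_eq_true {u v m s t : ℕ} {k : ℕ → ℕ → ℕ → Bool} (h : tryColor u v m s t k = true)
    (hm : m &&& (2 ^ u ||| 2 ^ v) = 0) (hs : tableEntry s u ≠ v) (ht : tableEntry t u ≠ v) :
    k (m ||| (2 ^ u ||| 2 ^ v)) (tableJoin s u v (tableEntry s u) (tableEntry s v))
      (tableJoin t u v (tableEntry t u) (tableEntry t v)) = true := by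
  have hs' : Nat.beq (tableEntry s u) v = false :=
    Bool.eq_false_iff.2 fun h => hs (Nat.eq_of_beq_eq_true h)
  have ht' : Nat.beq (tableEntry t u) v = false :=
    Bool.eq_false_iff.2 fun h => ht (Nat.eq_of_beq_eq_true h)
  simpa only [tryColor, withValue_eq, hm, hs', ht', Nat.beq_refl, cond_true, cond_false] using h

/-- The type of functions of the state of the search: the ends `m₀`, `m₁`, `m₂` of the edges of
each colour, and the path tables `t₀`, `t₁`, `t₂`, where `tᵢ` omits the colour `i`. -/
abbrev StateFun := ℕ → ℕ → ℕ → ℕ → ℕ → ℕ → Bool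

def tryColor₀ (u v : ℕ) (k : StateFun) : StateFun := fun m₀ m₁ m₂ t₀ t₁ t₂ =>
  tryColor u v m₀ t₁ t₂ fun m₀ t₁ t₂ => k m₀ m₁ m₂ t₀ t₁ t₂

def tryColor₁ (u v : ℕ) (k : StateFun) : StateFun := fun m₀ m₁ m₂ t₀ t₁ t₂ =>
  tryColor u v m₁ t₀ t₂ fun m₁ t₀ t₂ => k m₀ m₁ m₂ t₀ t₁ t₂

def tryColor₂ (u v : ℕ) (k : StateFun) : StateFun := fun m₀ m₁ m₂ t₀ t₁ t₂ =>
  tryColor u v m₂ t₀ t₁ fun m₂ t₀ t₁ => k m₀ m₁ m₂ t₀ t₁ t₂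

/-- Search for a colouring of the listed edges. The result is `true` if there is none. -/
def colorSearch (l : List (ℕ × ℕ)) : StateFun :=
  List.rec (motive := fun _ => StateFun) (fun _ _ _ _ _ _ => false)
    (fun p _ k m₀ m₁ m₂ t₀ t₁ t₂ =>
      (tryColor₀ p.1 p.2 k m₀ m₁ m₂ t₀ t₁ t₂ && tryColor₁ p.1 p.2 k m₀ m₁ m₂ t₀ t₁ t₂) &&
        tryColor₂ p.1 p.2 k m₀ m₁ m₂ t₀ t₁ t₂) l

/-- Search for a colouring of the edges `uv` and `uw` and the listed edges in which `uv` and `uw`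
have the colours `0` and `1`. -/
def colorSearchFrom (u v w : ℕ) (l : List (ℕ × ℕ)) : Bool :=
  withValue tableId fun t =>
    tryColor₀ u v (tryColor₁ u w (colorSearch l)) 0 0 0 t t t

variable {n : ℕ} {E : Fin 3 → ℕ → ℕ → Prop} {P : ℕ → ℕ → Prop} {u v z : ℕ}

/-- The state `m₀, …, t₂` describes the coloured edges in `P`. -/
structure IsSearchState (E : Fin 3 → ℕ → ℕ → Prop) (P : ℕ → ℕ → Prop)
    (m₀ m₁ m₂ t₀ t₁ t₂ : ℕ) : Prop where
  used₀ : ∀ x, m₀.testBit x = true ↔ IsUsed E P 0 x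
  used₁ : ∀ x, m₁.testBit x = true ↔ IsUsed E P 1 x
  used₂ : ∀ x, m₂.testBit x = true ↔ IsUsed E P 2 x
  table₀ : IsPathTable E P 1 2 (tableEntry t₀)
  table₁ : IsPathTable E P 0 2 (tableEntry t₁)
  table₂ : IsPathTable E P 0 1 (tableEntry t₂)

theorem isSearchState_empty :
    IsSearchState E (fun _ _ => False) 0 0 0 tableId tableId tableId := by
  have h : ∀ (i : Fin 3) (x : ℕ), Nat.testBit 0 x = true ↔ IsUsed E (fun _ _ => False) i x := by
    simp [IsUsed]
  have h' := tableEntry_tableId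
  exact ⟨h 0, h 1, h 2, isPathTable_empty h', isPathTable_empty h', isPathTable_empty h'⟩

theorem testBit_lor_two_pow (m u v x : ℕ) : (m ||| (2 ^ u ||| 2 ^ v)).testBit x = true ↔
    m.testBit x = true ∨ x = u ∨ x = v := by
  rw [Nat.testBit_lor, Nat.testBit_lor, Nat.testBit_two_pow, Nat.testBit_two_pow, Bool.or_eq_true,
    Bool.or_eq_true, decide_eq_true_iff, decide_eq_true_iff, eq_comm (a := u), eq_comm (a := v)]

theorem land_two_pow_eq_zero {m u v : ℕ} (hu : ¬ m.testBit u = true) (hv : ¬ m.testBit v = true) :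
    m &&& (2 ^ u ||| 2 ^ v) = 0 := by
  apply Nat.eq_of_testBit_eq
  intro x
  rw [Nat.testBit_land, Nat.testBit_lor, Nat.testBit_two_pow, Nat.testBit_two_pow, Nat.zero_testBit]
  by_cases h1 : u = x
  · subst h1; simp [hu]
  by_cases h2 : v = x
  · subst h2; simp [hv]
  simp [h1, h2]

/-- The edge `uv` can be added to `P`, and the edges of `P` and `uv` avoid the vertex `z`. -/
structure IsNewEdge (n z : ℕ) (P : ℕ → ℕ → Prop) (u v : ℕ) : Prop where
  le : n ≤ 64
  lt : z < n
  left_lt : u < n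
  right_lt : v < n
  ne : u ≠ v
  left_ne : z ≠ u
  right_ne : z ≠ v
  not_mem : ¬ P u v
  not_mem' : ¬ P v u
  avoid : ∀ y, ¬ P z y

theorem IsPathTable.step (hE : IsPerfectRel n E) {a b : Fin 3} {t : ℕ}
    (hL : IsPathTable E P a b (tableEntry t)) (hab : a ≠ b) (h : E a u v)
    (hnew : IsNewEdge n z P u v) :
    tableEntry t u ≠ v ∧ IsPathTable E (SimpleGraph.addEdge P u v) a b
      (tableEntry (tableJoin t u v (tableEntry t u) (tableEntry t v))) := by
  obtain ⟨hn, hz, hu, hv, hne, hzu, hzv, hP, hP', hzP⟩ := hnew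
  have hLu := hL.ne_of_rel hE hab hn hu h hP hP' hne hz hzP hzu hzv
  refine ⟨hLu, ?_⟩
  rw [tableEntry_tableJoin (by omega) (by omega)
    (hL u (by omega) fun hf => not_isUsed hE h hP hf.1).2.1
    (hL v (by omega) fun hf => not_isUsed hE (hE.symm h) hP' hf.1).2.1 hne]
  exact hL.addEdge hE hab (by omega) (by omega) h hP hP' hne hLu

theorem used_step (hE : IsPerfectRel n E) {a : Fin 3} {m : ℕ}
    (hm : ∀ x, m.testBit x = true ↔ IsUsed E P a x) (h : E a u v) (hnew : IsNewEdge n z P u v) :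
    m &&& (2 ^ u ||| 2 ^ v) = 0 ∧ ∀ x, (m ||| (2 ^ u ||| 2 ^ v)).testBit x = true ↔
      IsUsed E (addEdge P u v) a x := by
  refine ⟨land_two_pow_eq_zero ?_ ?_, fun x => ?_⟩
  · rw [hm]; exact not_isUsed hE h hnew.not_mem
  · rw [hm]; exact not_isUsed hE (hE.symm h) hnew.not_mem'
  · rw [testBit_lor_two_pow, hm, isUsed_addEdge hE h]

variable {m₀ m₁ m₂ t₀ t₁ t₂ : ℕ} {k : StateFun}

/-- If the actual colouring gives `uv` the colour 0, none of the pruning tests can reject this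
choice. The answer `true` is thus inherited by the continuation, in a state that describes `P` and
`uv`. -/
theorem IsSearchState.tryColor₀ (hE : IsPerfectRel n E)
    (hst : IsSearchState E P m₀ m₁ m₂ t₀ t₁ t₂) (h : E 0 u v) (hnew : IsNewEdge n z P u v)
    (hk : tryColor₀ u v k m₀ m₁ m₂ t₀ t₁ t₂ = true) :
    ∃ m₀ m₁ m₂ t₀ t₁ t₂, IsSearchState E (addEdge P u v) m₀ m₁ m₂ t₀ t₁ t₂ ∧
      k m₀ m₁ m₂ t₀ t₁ t₂ = true := by
  obtain ⟨h1, h2⟩ := used_step hE hst.used₀ h hnew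
  obtain ⟨h3, h4⟩ := hst.table₁.step hE (by decide) h hnew
  obtain ⟨h5, h6⟩ := hst.table₂.step hE (by decide) h hnew
  refine ⟨_, _, _, _, _, _, ⟨h2, fun x => ?_, fun x => ?_, ?_, h4, h6⟩,
    tryColor_eq_true
      (k := fun m₀ t₁ t₂ => k m₀ m₁ m₂ t₀ t₁ t₂) hk h1 h3 h5⟩
  · rw [hst.used₁, isUsed_addEdge_of_ne hE h (by decide)]
  · rw [hst.used₂, isUsed_addEdge_of_ne hE h (by decide)]
  · exact hst.table₀.addEdge_of_ne hE h (by decide) (by decide)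

theorem IsSearchState.tryColor₁ (hE : IsPerfectRel n E)
    (hst : IsSearchState E P m₀ m₁ m₂ t₀ t₁ t₂) (h : E 1 u v) (hnew : IsNewEdge n z P u v)
    (hk : tryColor₁ u v k m₀ m₁ m₂ t₀ t₁ t₂ = true) :
    ∃ m₀ m₁ m₂ t₀ t₁ t₂, IsSearchState E (addEdge P u v) m₀ m₁ m₂ t₀ t₁ t₂ ∧
      k m₀ m₁ m₂ t₀ t₁ t₂ = true := by
  obtain ⟨h1, h2⟩ := used_step hE hst.used₁ h hnew
  obtain ⟨h3, h4⟩ := hst.table₀.step hE (by decide) h hnew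
  -- `IsPathTable.step` expects the new colour first in the pair, hence the exchange.
  obtain ⟨h5, h6⟩ := hst.table₂.comm.step hE (by decide) h hnew
  refine ⟨_, _, _, _, _, _, ⟨fun x => ?_, h2, fun x => ?_, h4, ?_, h6.comm⟩,
    tryColor_eq_true
      (k := fun m₁ t₀ t₂ => k m₀ m₁ m₂ t₀ t₁ t₂) hk h1 h3 h5⟩
  · rw [hst.used₀, isUsed_addEdge_of_ne hE h (by decide)]
  · rw [hst.used₂, isUsed_addEdge_of_ne hE h (by decide)]
  · exact hst.table₁.addEdge_of_ne hE h (by decide) (by decide)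

theorem IsSearchState.tryColor₂ (hE : IsPerfectRel n E)
    (hst : IsSearchState E P m₀ m₁ m₂ t₀ t₁ t₂) (h : E 2 u v) (hnew : IsNewEdge n z P u v)
    (hk : tryColor₂ u v k m₀ m₁ m₂ t₀ t₁ t₂ = true) :
    ∃ m₀ m₁ m₂ t₀ t₁ t₂, IsSearchState E (addEdge P u v) m₀ m₁ m₂ t₀ t₁ t₂ ∧
      k m₀ m₁ m₂ t₀ t₁ t₂ = true := by
  obtain ⟨h1, h2⟩ := used_step hE hst.used₂ h hnew
  obtain ⟨h3, h4⟩ := hst.table₀.comm.step hE (by decide) h hnew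
  obtain ⟨h5, h6⟩ := hst.table₁.comm.step hE (by decide) h hnew
  refine ⟨_, _, _, _, _, _, ⟨fun x => ?_, fun x => ?_, h2, h4.comm, h6.comm, ?_⟩,
    tryColor_eq_true
      (k := fun m₂ t₀ t₁ => k m₀ m₁ m₂ t₀ t₁ t₂) hk h1 h3 h5⟩
  · rw [hst.used₀, isUsed_addEdge_of_ne hE h (by decide)]
  · rw [hst.used₁, isUsed_addEdge_of_ne hE h (by decide)]
  · exact hst.table₂.addEdge_of_ne hE h (by decide) (by decide)

/-- The list `l` consists of different edges that avoid the vertex `z`. -/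
def IsEdgeList (n z : ℕ) (l : List (ℕ × ℕ)) : Prop :=
  (∀ p ∈ l, p.1 < n ∧ p.2 < n ∧ p.1 ≠ p.2 ∧ z ≠ p.1 ∧ z ≠ p.2) ∧
    l.Pairwise fun p q => p ≠ q ∧ p ≠ q.swap

instance (n z : ℕ) (l : List (ℕ × ℕ)) : Decidable (IsEdgeList n z l) :=
  inferInstanceAs (Decidable (_ ∧ _))

/-- What remains to be searched after the edges in `P`. -/
structure IsRest (n z : ℕ) (E : Fin 3 → ℕ → ℕ → Prop) (P : ℕ → ℕ → Prop) (l : List (ℕ × ℕ)) :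
    Prop where
  le : n ≤ 64
  lt : z < n
  isEdgeList : IsEdgeList n z l
  avoid : ∀ y, ¬ P z y
  not_mem : ∀ p ∈ l, ¬ P p.1 p.2 ∧ ¬ P p.2 p.1
  exists_color : ∀ p ∈ l, ∃ i, E i p.1 p.2

theorem IsRest.isNewEdge {l : List (ℕ × ℕ)} {p : ℕ × ℕ} (h : IsRest n z E P (p :: l)) :
    IsNewEdge n z P p.1 p.2 := by
  obtain ⟨h1, h2, h3, h4, h5⟩ := h.isEdgeList.1 p List.mem_cons_self
  obtain ⟨h6, h7⟩ := h.not_mem p List.mem_cons_self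
  exact ⟨h.le, h.lt, h1, h2, h3, h4, h5, h6, h7, h.avoid⟩

theorem IsRest.tail {l : List (ℕ × ℕ)} {p : ℕ × ℕ} (h : IsRest n z E P (p :: l)) :
    IsRest n z E (addEdge P p.1 p.2) l := by
  obtain ⟨hl, hp⟩ := h.isEdgeList
  obtain ⟨hpl, hp⟩ := List.pairwise_cons.1 hp
  obtain ⟨h1, h2, h3, h4, h5⟩ := hl p List.mem_cons_self
  refine ⟨h.le, h.lt, ⟨fun q hq => hl q (List.mem_cons_of_mem p hq), hp⟩, ?_, fun q hq => ?_,
    fun q hq => h.exists_color q (List.mem_cons_of_mem p hq)⟩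
  · rintro y (hy | ⟨hy, -⟩ | ⟨hy, -⟩)
    · exact h.avoid y hy
    · exact h4 hy
    · exact h5 hy
  · obtain ⟨h6, h7⟩ := h.not_mem q (List.mem_cons_of_mem p hq)
    obtain ⟨h8, h9⟩ := hpl q hq
    constructor
    · rintro (hy | ⟨hx, hy⟩ | ⟨hx, hy⟩)
      · exact h6 hy
      · exact h8 (Prod.ext hx.symm hy.symm)
      · exact h9 (Prod.ext hy.symm hx.symm)
    · rintro (hy | ⟨hx, hy⟩ | ⟨hx, hy⟩)
      · exact h7 hy
      · exact h9 (Prod.ext hx.symm hy.symm)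
      · exact h8 (Prod.ext hy.symm hx.symm)

/-- At each edge, follow the branch of its actual colour. A `true` answer would propagate to the
empty list, where the search returns `false`. -/
theorem IsSearchState.colorSearch_ne_true (hE : IsPerfectRel n E) (l : List (ℕ × ℕ)) :
    ∀ {P : ℕ → ℕ → Prop} {m₀ m₁ m₂ t₀ t₁ t₂ : ℕ}, IsSearchState E P m₀ m₁ m₂ t₀ t₁ t₂ →
      IsRest n z E P l → colorSearch l m₀ m₁ m₂ t₀ t₁ t₂ ≠ true := by
  induction l with
  | nil => intro _ _ _ _ _ _ _ _ _ h; exact Bool.false_ne_true h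
  | cons p l ih =>
    intro P m₀ m₁ m₂ t₀ t₁ t₂ hst hl h
    obtain ⟨⟨h0, h1⟩, h2⟩ := by
      simpa only [Bool.and_eq_true] using show ((_ && _) && _) = true from h
    obtain ⟨i, hi⟩ := hl.exists_color p List.mem_cons_self
    have hnew := hl.isNewEdge
    obtain ⟨_, _, _, _, _, _, hst', hk⟩ : ∃ m₀ m₁ m₂ t₀ t₁ t₂,
        IsSearchState E (addEdge P p.1 p.2) m₀ m₁ m₂ t₀ t₁ t₂ ∧
          colorSearch l m₀ m₁ m₂ t₀ t₁ t₂ = true := by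
      fin_cases i
      · exact hst.tryColor₀ hE hi hnew h0
      · exact hst.tryColor₁ hE hi hnew h1
      · exact hst.tryColor₂ hE hi hnew h2
    exact ih hst' hl.tail hk

theorem colorSearchFrom_ne_true (hE : IsPerfectRel n E) {w : ℕ} {l : List (ℕ × ℕ)}
    (hn : n ≤ 64) (hz : z < n) (hl : IsEdgeList n z ((u, v) :: (u, w) :: l))
    (hcol : ∀ p ∈ l, ∃ i, E i p.1 p.2) (h0 : E 0 u v) (h1 : E 1 u w) :
    colorSearchFrom u v w l ≠ true := by
  intro h
  rw [colorSearchFrom, withValue_eq] at h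
  have hrest : IsRest n z E (fun _ _ => False) ((u, v) :: (u, w) :: l) := by
    refine ⟨hn, hz, hl, fun _ => id, fun _ _ => ⟨id, id⟩, fun p hp => ?_⟩
    rcases List.mem_cons.1 hp with rfl | hp
    · exact ⟨0, h0⟩
    rcases List.mem_cons.1 hp with rfl | hp
    · exact ⟨1, h1⟩
    · exact hcol p hp
  obtain ⟨_, _, _, _, _, _, hst, h⟩ := isSearchState_empty.tryColor₀ hE h0 hrest.isNewEdge h
  obtain ⟨_, _, _, _, _, _, hst, h⟩ := hst.tryColor₁ hE h1 hrest.tail.isNewEdge h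
  exact hst.colorSearch_ne_true hE l hrest.tail.tail h

theorem IsPerfectColoring.isPerfectRel {X : SimpleGraph (Fin n)} {c : X.Dart → Fin 3}
    (hc : IsPerfectColoring X c) : IsPerfectRel n fun i u v =>
      ∃ d : X.Dart, (d.fst : ℕ) = u ∧ (d.snd : ℕ) = v ∧ c d = i := by
  refine ⟨?_, ?_, ?_, ?_⟩
  · rintro i u v ⟨d, rfl, rfl, rfl⟩
    exact ⟨d.symm, rfl, rfl, hc.symm d⟩
  · rintro i u v w ⟨d, rfl, rfl, rfl⟩ ⟨d', h, rfl, h'⟩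
    rw [hc.proper d d' (Fin.ext h.symm) h'.symm]
  · rintro i j u v ⟨d, rfl, rfl, rfl⟩ ⟨d', h, h', rfl⟩
    congr 1
    ext
    · exact h.symm
    · exact h'.symm
  · intro a b hab S ⟨x, hx, hxn⟩ hS
    have hthird : ∀ a b : Fin 3, a ≠ b → ∃ k, ∀ l, l ≠ k → l = a ∨ l = b := by decide
    obtain ⟨k, hk⟩ := hthird a b hab
    -- Being closed under the colours `a` and `b` means being closed under every colour except the
    -- third, `k`.
    have := hc.eq_univ k {y | (y : ℕ) ∈ S} ⟨⟨x, hxn⟩, hx⟩ fun d hd hdk =>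
      hS _ hd _ ((hk _ hdk).imp (fun h => ⟨d, rfl, rfl, h⟩) fun h => ⟨d, rfl, rfl, h⟩)
    intro y hy
    have : (⟨y, hy⟩ : Fin n) ∈ {y : Fin n | (y : ℕ) ∈ S} := this ▸ Set.mem_univ _
    exact this

/-- If the search fails then there is no perfect colouring. -/
theorem not_isPerfectColoring_of_colorSearchFrom {X : SimpleGraph (Fin n)} {w : ℕ}
    {l : List (ℕ × ℕ)} (hn : n ≤ 64) (hz : z < n) (hl : IsEdgeList n z ((u, v) :: (u, w) :: l))
    (hX : ∀ p ∈ (u, v) :: (u, w) :: l, ∃ x y, X.Adj x y ∧ (x : ℕ) = p.1 ∧ (y : ℕ) = p.2)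
    (h : colorSearchFrom u v w l = true) (c : X.Dart → Fin 3) : ¬ IsPerfectColoring X c := by
  intro hc
  have hdart : ∀ p ∈ (u, v) :: (u, w) :: l,
      ∃ d : X.Dart, (d.fst : ℕ) = p.1 ∧ (d.snd : ℕ) = p.2 := fun p hp => by
    obtain ⟨x, y, hxy, hx, hy⟩ := hX p hp
    exact ⟨⟨(x, y), hxy⟩, hx, hy⟩
  obtain ⟨d, hd1, hd2⟩ := hdart (u, v) (by simp)
  obtain ⟨d', hd1', hd2'⟩ := hdart (u, w) (by simp)
  have hne : c d ≠ c d' := fun h => by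
    have hdd := hc.proper d d' (Fin.ext (hd1.trans hd1'.symm)) h
    rw [hdd, hd2'] at hd2
    have := List.pairwise_cons.1 hl.2
    exact (this.1 (u, w) (by simp)).1 (Prod.ext rfl hd2.symm)
  have hperm : ∀ i j : Fin 3, i ≠ j → ∃ σ : Equiv.Perm (Fin 3), σ i = 0 ∧ σ j = 1 := by decide
  obtain ⟨σ, h0, h1⟩ := hperm _ _ hne
  refine colorSearchFrom_ne_true (hc.comp_perm σ).isPerfectRel hn hz hl (fun p hp => ?_)
    ⟨d, hd1, hd2, h0⟩ ⟨d', hd1', hd2', h1⟩ h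
  obtain ⟨e, he1, he2⟩ := hdart p (by simp [hp])
  exact ⟨_, e, he1, he2, rfl⟩

end Search

/-! ### Graphs given by neighbour tables, with checkable certificates. -/

section Table

/-- The `i`-th row of a table. -/
def tableRow (t : List (List ℕ)) (i : ℕ) : List ℕ := t.getD i []

/-- The graph on `0, …, n - 1` with the neighbours of each vertex listed in a table. -/
def tableGraph (n : ℕ) (t : List (List ℕ)) : SimpleGraph (Fin n) :=
  fromRel fun i j => (j : ℕ) ∈ tableRow t i

instance (n : ℕ) (t : List (List ℕ)) : DecidableRel (tableGraph n t).Adj :=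
  fun u v => inferInstanceAs (Decidable ((fromRel _).Adj u v))

/-- The rows of the table are the neighbours of the vertices of a cubic graph. -/
def IsCubicTable (n : ℕ) (t : List (List ℕ)) : Prop :=
  ∀ i < n, (tableRow t i).length = 3 ∧ (tableRow t i).Nodup ∧
    ∀ j ∈ tableRow t i, j < n ∧ j ≠ i ∧ i ∈ tableRow t j

instance (n : ℕ) (t : List (List ℕ)) : Decidable (IsCubicTable n t) :=
  inferInstanceAs (Decidable (∀ i < n, _))

/-- The list `p` maps every vertex to itself or to a neighbour, and iterating it leads to `0`. -/
def IsParentTable (n : ℕ) (t : List (List ℕ)) (p : List ℕ) : Prop :=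
  ∀ i < n, p.getD i 0 < n ∧ (p.getD i 0 = i ∨ p.getD i 0 ∈ tableRow t i) ∧
    (fun i => p.getD i 0)^[n] i = 0

instance (n : ℕ) (t : List (List ℕ)) (p : List ℕ) : Decidable (IsParentTable n t p) :=
  inferInstanceAs (Decidable (∀ i < n, _))

/-- The list `π` is the list of values of an automorphism. -/
def IsAutomorphismTable (n : ℕ) (t : List (List ℕ)) (π : List ℕ) : Prop :=
  π.length = n ∧ π.Nodup ∧ ∀ i < n, π.getD i 0 < n ∧
    ∀ j ∈ tableRow t i, π.getD j 0 ∈ tableRow t (π.getD i 0)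

instance (n : ℕ) (t : List (List ℕ)) (π : List ℕ) : Decidable (IsAutomorphismTable n t π) :=
  inferInstanceAs (Decidable (_ ∧ _))

/-- A table for a connected cubic graph, with an automorphism `ρ` that fixes the vertex `0` and
rotates its neighbours, and an automorphism `τ` that maps `0` to its first neighbour. -/
def IsArcTransitiveTable (n : ℕ) (t : List (List ℕ)) (p ρ τ : List ℕ) : Prop :=
  0 < n ∧ IsCubicTable n t ∧ IsParentTable n t p ∧
    IsAutomorphismTable n t ρ ∧ IsAutomorphismTable n t τ ∧ ρ.getD 0 0 = 0 ∧
    tableRow t 0 = [τ.getD 0 0, ρ.getD (τ.getD 0 0) 0, ρ.getD (ρ.getD (τ.getD 0 0) 0) 0]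

instance (n : ℕ) (t : List (List ℕ)) (p ρ τ : List ℕ) :
    Decidable (IsArcTransitiveTable n t p ρ τ) :=
  inferInstanceAs (Decidable (_ ∧ _))

variable {n : ℕ} {t : List (List ℕ)} {p ρ τ π : List ℕ}

theorem IsCubicTable.adj_iff (ht : IsCubicTable n t) {i j : Fin n} :
    (tableGraph n t).Adj i j ↔ (j : ℕ) ∈ tableRow t i := by
  rw [tableGraph, fromRel_adj]
  constructor
  · rintro ⟨-, h | h⟩
    · exact h
    · exact ((ht j j.2).2.2 i h).2.2
  · intro h
    exact ⟨fun hij => ((ht i i.2).2.2 j h).2.1 (by rw [hij]), Or.inl h⟩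

theorem IsCubicTable.isRegularOfDegree (ht : IsCubicTable n t) :
    (tableGraph n t).IsRegularOfDegree 3 := by
  intro i
  have h : ((tableGraph n t).neighborFinset i).map Fin.valEmbedding = (tableRow t i).toFinset := by
    ext j
    simp only [Finset.mem_map, mem_neighborFinset, ht.adj_iff, Fin.valEmbedding_apply,
      List.mem_toFinset]
    constructor
    · rintro ⟨k, hk, rfl⟩
      exact hk
    · exact fun hj => ⟨⟨j, ((ht i i.2).2.2 j hj).1⟩, hj, rfl⟩
  rw [← card_neighborFinset_eq_degree, ← Finset.card_map Fin.valEmbedding, h,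
    List.toFinset_card_of_nodup (ht i i.2).2.1, (ht i i.2).1]

theorem IsParentTable.connected (h0 : 0 < n) (ht : IsCubicTable n t) (hp : IsParentTable n t p) :
    (tableGraph n t).Connected := by
  have step : ∀ k i (hi : i < n), ∃ hk : (fun i => p.getD i 0)^[k] i < n,
      (tableGraph n t).Reachable ⟨i, hi⟩ ⟨_, hk⟩ := by
    intro k
    induction k with
    | zero => exact fun i hi => ⟨hi, Reachable.refl _⟩
    | succ k ih =>
      intro i hi
      obtain ⟨hpi, h, -⟩ := hp i hi
      obtain ⟨hk, hr⟩ := ih _ hpi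
      refine ⟨hk, Reachable.trans ?_ hr⟩
      rcases h with h | h
      · simp only [h]; exact Reachable.refl _
      · exact Adj.reachable (ht.adj_iff.2 h)
  have hroot : ∀ i, (tableGraph n t).Reachable i ⟨0, h0⟩ := fun i => by
    obtain ⟨hk, hr⟩ := step n i i.2
    simpa only [(hp i i.2).2.2] using hr
  exact (connected_iff _).2 ⟨fun i j => (hroot i).trans (hroot j).symm, ⟨⟨0, h0⟩⟩⟩

/-- An injective endomorphism of a finite regular graph is an automorphism. -/
theorem exists_iso_of_injective {V : Type*} [Fintype V] [DecidableEq V] {X : SimpleGraph V}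
    [DecidableRel X.Adj] {d : ℕ} (hX : X.IsRegularOfDegree d) (f : V → V)
    (hf : Function.Injective f) (hadj : ∀ x y, X.Adj x y → X.Adj (f x) (f y)) :
    ∃ φ : X ≃g X, ∀ x, φ x = f x := by
  refine ⟨⟨Equiv.ofBijective f (Finite.injective_iff_bijective.1 hf), ?_⟩, fun _ => rfl⟩
  intro x y
  refine ⟨fun h => ?_, hadj x y⟩
  have himg : (X.neighborFinset x).image f = X.neighborFinset (f x) := by
    refine Finset.eq_of_subset_of_card_le (fun z hz => ?_) ?_
    · obtain ⟨y, hy, rfl⟩ := Finset.mem_image.1 hz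
      exact (mem_neighborFinset ..).2 (hadj _ _ ((mem_neighborFinset ..).1 hy))
    · rw [Finset.card_image_of_injective _ hf, card_neighborFinset_eq_degree,
        card_neighborFinset_eq_degree, hX.degree_eq, hX.degree_eq]
  have hy : f y ∈ (X.neighborFinset x).image f := himg ▸ (mem_neighborFinset ..).2 h
  obtain ⟨z, hz, hzy⟩ := Finset.mem_image.1 hy
  exact hf hzy ▸ (mem_neighborFinset ..).1 hz

theorem IsAutomorphismTable.exists_iso (ht : IsCubicTable n t) (hπ : IsAutomorphismTable n t π) :
    ∃ φ : tableGraph n t ≃g tableGraph n t, ∀ i, (φ i : ℕ) = π.getD i 0 := by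
  obtain ⟨hlen, hnodup, h⟩ := hπ
  obtain ⟨φ, hφ⟩ := exists_iso_of_injective ht.isRegularOfDegree
    (fun i => ⟨π.getD i 0, (h i i.2).1⟩) (fun i j hij => by
      have hij : π.getD i 0 = π.getD j 0 := congrArg Fin.val hij
      rw [List.getD_eq_getElem _ _ (by omega), List.getD_eq_getElem _ _ (by omega)] at hij
      exact Fin.ext ((hnodup.getElem_inj_iff).1 hij))
    (fun i j hij => ht.adj_iff.2 ((h i i.2).2 j (ht.adj_iff.1 hij)))
  exact ⟨φ, fun i => congrArg Fin.val (hφ i)⟩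

theorem IsArcTransitiveTable.isArcTransitive (h : IsArcTransitiveTable n t p ρ τ) :
    (tableGraph n t).IsArcTransitive := by
  obtain ⟨h0, ht, hp, hρ, hτ, hρ0, hrow⟩ := h
  obtain ⟨φ, hφ⟩ := hρ.exists_iso ht
  obtain ⟨ψ, hψ⟩ := hτ.exists_iso ht
  have hφ0 : φ ⟨0, h0⟩ = ⟨0, h0⟩ := Fin.ext ((hφ _).trans hρ0)
  refine (hp.connected h0 ht).isArcTransitive (v := ⟨0, h0⟩) ψ rfl fun u hu => ?_
  rw [ht.adj_iff, hrow] at hu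
  simp only [List.mem_cons, List.not_mem_nil, or_false] at hu
  -- The first neighbour of 0 is `τ 0`; the other two are its images under `ρ` and `ρ²`.
  rcases hu with hu | hu | hu
  · exact ⟨Iso.refl, rfl, Fin.ext (by rw [hu]; exact hψ _)⟩
  · exact ⟨φ, hφ0, Fin.ext (by rw [hφ, hψ, hu])⟩
  · refine ⟨φ.trans φ, ?_, Fin.ext ?_⟩
    · rw [RelIso.trans_apply, hφ0, hφ0]
    · rw [RelIso.trans_apply, hφ, hφ, hψ, hu]

variable {V : Type*} [Fintype V] [DecidableEq V] {X : SimpleGraph V} [DecidableRel X.Adj]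
  [DecidableEq (X.Dart × Fin 2)] [(arcGraph 2 X).LocallyFinite]

/-- The vertices of `X` are labelled by those of the graph of a table. -/
theorem IsArcTransitiveTable.isSixValentCounterexample (h : IsArcTransitiveTable n t p ρ τ)
    (f : Fin n → V) (hf : Function.Bijective f)
    (hadj : ∀ i j, X.Adj (f i) (f j) ↔ (j : ℕ) ∈ tableRow t i)
    (hcol : ∀ c, ¬ IsPerfectColoring (tableGraph n t) c) :
    (arcGraph 2 X).IsSixValentCounterexample := by
  let e : X ≃g tableGraph n t := RelIso.symm
    ⟨Equiv.ofBijective f hf, fun {i j} => (hadj i j).trans h.2.1.adj_iff.symm⟩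
  refine isSixValentCounterexample_arcGraph (e.connected_iff.2 (h.2.2.1.connected h.1 h.2.1))
    (fun x => ?_) (h.isArcTransitive.of_iso e) fun c hc => hcol _ (hc.of_iso e)
  rw [← e.degree_eq x]
  exact h.2.1.isRegularOfDegree (e x)

/-- A graph with a bipartition into two classes of even size. -/
theorem IsArcTransitiveTable.isSixValentCounterexample_of_even
    (h : IsArcTransitiveTable n t p ρ τ)
    (f : Fin n → V) (hf : Function.Bijective f)
    (hadj : ∀ i j, X.Adj (f i) (f j) ↔ (j : ℕ) ∈ tableRow t i)
    (s : ℕ → Bool) (hs : ∀ i < n, ∀ j ∈ tableRow t i, s i = !s j) {m : ℕ} (hm : 0 < m)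
    (hcard : Fintype.card {i : Fin n // s i = false} = m + m) :
    (arcGraph 2 X).IsSixValentCounterexample :=
  h.isSixValentCounterexample f hf hadj <|
    not_isPerfectColoring_of_even h.2.1.isRegularOfDegree (fun i => s i)
      (fun i j hij => hs i i.2 j (h.2.1.adj_iff.1 hij)) (by omega) ⟨m, hcard⟩

/-- A graph for which the search for a perfect colouring fails. -/
theorem IsArcTransitiveTable.isSixValentCounterexample_of_search
    (h : IsArcTransitiveTable n t p ρ τ)
    (f : Fin n → V) (hf : Function.Bijective f)
    (hadj : ∀ i j, X.Adj (f i) (f j) ↔ (j : ℕ) ∈ tableRow t i)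
    {u v w z : ℕ} {l : List (ℕ × ℕ)} (hn : n ≤ 64) (hz : z < n)
    (hl : IsEdgeList n z ((u, v) :: (u, w) :: l))
    (hlt : ∀ p ∈ (u, v) :: (u, w) :: l, p.2 ∈ tableRow t p.1)
    (hsearch : colorSearchFrom u v w l = true) :
    (arcGraph 2 X).IsSixValentCounterexample :=
  h.isSixValentCounterexample f hf hadj <|
    not_isPerfectColoring_of_colorSearchFrom hn hz hl (fun p hp =>
      ⟨⟨p.1, (hl.1 p hp).1⟩, ⟨p.2, (hl.1 p hp).2.1⟩, h.2.1.adj_iff.2 (hlt p hp), rfl, rfl⟩) hsearch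

end Table

/-! ### The twelve graphs: labellings, tables and certificates. -/

section Examples

/-- A labelling of the vertices of `GP(n, k)`. -/
def petersenLabel (n i : ℕ) : ZMod n × Bool := ((i / 2 : ℕ), i.testBit 0)

/-- A labelling of the vertices of `{6, 3}_{n, 0}`. -/
def torusLabel (n i : ℕ) : (ZMod n × ZMod n) × Bool :=
  (((i / 2 / n : ℕ), (i / 2 % n : ℕ)), i.testBit 0)

/-- A labelling of the vertices of the Petersen graph. -/
def petersenPairs : Fin 10 → Finset (Fin 5) :=
  ![{0, 1}, {0, 2}, {0, 3}, {0, 4}, {1, 2}, {1, 3}, {1, 4}, {2, 3}, {2, 4}, {3, 4}]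

/-- A labelling of the vertices of the Coxeter graph. -/
def coxeterTriples : Fin 28 → Finset (ZMod 7) :=
  ![{0, 1, 2}, {0, 1, 4}, {0, 1, 5}, {0, 1, 6}, {0, 2, 3}, {0, 2, 4}, {0, 2, 5}, {0, 3, 4}, {0, 3,
  5}, {0, 3, 6}, {0, 4, 6}, {0, 5, 6}, {1, 2, 3}, {1, 2, 5}, {1, 2, 6}, {1, 3, 4}, {1, 3, 5}, {1,
  3, 6}, {1, 4, 5}, {1, 4, 6}, {2, 3, 4}, {2, 3, 6}, {2, 4, 5}, {2, 4, 6}, {2, 5, 6}, {3, 4, 5},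
  {3, 5, 6}, {4, 5, 6}]

/-- A labelling of the duads. -/
def duadList : Fin 15 → Finset (Fin 6) :=
  ![{0, 1}, {0, 2}, {0, 3}, {0, 4}, {0, 5}, {1, 2}, {1, 3}, {1, 4}, {1, 5}, {2, 3}, {2, 4}, {2,
  5}, {3, 4}, {3, 5}, {4, 5}]

/-- A labelling of the synthemes. -/
def synthemeList : Fin 15 → Finset (Finset (Fin 6)) :=
  ![{{0, 1}, {2, 3}, {4, 5}}, {{0, 1}, {2, 4}, {3, 5}}, {{0, 1}, {2, 5}, {3, 4}}, {{0, 2}, {1, 3},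
  {4, 5}}, {{0, 2}, {1, 4}, {3, 5}}, {{0, 2}, {1, 5}, {3, 4}}, {{0, 3}, {1, 2}, {4, 5}}, {{0, 3},
  {1, 4}, {2, 5}}, {{0, 3}, {1, 5}, {2, 4}}, {{0, 4}, {1, 2}, {3, 5}}, {{0, 4}, {1, 3}, {2, 5}},
  {{0, 4}, {1, 5}, {2, 3}}, {{0, 5}, {1, 2}, {3, 4}}, {{0, 5}, {1, 3}, {2, 4}}, {{0, 5}, {1, 4},
  {2, 3}}]

theorem petersenPairs_mem : ∀ i, petersenPairs i ∈ Finset.powersetCard 2 Finset.univ := by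
  decide +kernel

theorem coxeterTriples_mem : ∀ i, coxeterTriples i ∈
    (Finset.powersetCard 3 Finset.univ).filter (· ∉ fanoLines) := by
  decide +kernel

theorem duadList_mem : ∀ i, duadList i ∈ duads := by
  decide +kernel

theorem synthemeList_mem (i : Fin 15) : synthemeList i ∈ synthemes := by
  rw [synthemes, Finset.mem_filter, Finset.mem_powersetCard]
  revert i
  decide +kernel

/-- A labelling of the vertices of the Tutte–Coxeter graph. -/
def tutteCoxeterLabel (i : Fin 30) : ↥duads ⊕ ↥synthemes :=
  if h : i.1 < 15 then Sum.inl ⟨duadList ⟨i, h⟩, duadList_mem _⟩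
  else Sum.inr ⟨synthemeList ⟨i - 15, by omega⟩, synthemeList_mem _⟩

theorem card_duads : duads.card = 15 := by
  decide +kernel

theorem card_synthemes : synthemes.card = 15 := by
  decide +kernel

theorem bijective_tutteCoxeterLabel : Function.Bijective tutteCoxeterLabel := by
  refine (Fintype.bijective_iff_injective_and_card _).2 ⟨by decide +kernel, ?_⟩
  rw [Fintype.card_sum, Fintype.card_coe, Fintype.card_coe, card_duads, card_synthemes,
    Fintype.card_fin]

/-- The neighbours of the vertices of `F8`. -/
def tableF8 : List (List ℕ) :=
  [[1, 2, 4], [0, 3, 5], [0, 3, 6], [1, 2, 7], [0, 5, 6], [1, 4, 7], [2, 4, 7], [3, 5, 6]]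

theorem isArcTransitiveTable_F8 : IsArcTransitiveTable 8 tableF8
    [0, 0, 0, 1, 0, 1, 2, 3]
    [0, 2, 4, 6, 1, 3, 5, 7]
    [1, 0, 3, 2, 5, 4, 7, 6] := by
  decide +kernel

theorem isSixValentCounterexample_F8 : (arcGraph 2 F8).IsSixValentCounterexample :=
  isArcTransitiveTable_F8.isSixValentCounterexample_of_even
    -- A vertex of the cube is the string of binary digits of `i`.
    (fun i j => i.1.testBit j)
    ((Fintype.bijective_iff_injective_and_card _).2 
      ⟨by decide +kernel, by decide +kernel⟩)
    -- The bipartition by parity of the digit sum; `m` is half the size of a class.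
    (by decide +kernel) (fun i => (i + i / 2 + i / 4).testBit 0) (by decide +kernel) (m := 2)
    (by norm_num) (by decide +kernel)

/-- The neighbours of the vertices of `F10`. -/
def tableF10 : List (List ℕ) :=
  [[7, 8, 9], [5, 6, 9], [4, 6, 8], [4, 5, 7], [2, 3, 9], [1, 3, 8], [1, 2, 7], [0, 3, 6], [0, 2,
  5], [0, 1, 4]]

theorem isArcTransitiveTable_F10 : IsArcTransitiveTable 10 tableF10
    [0, 9, 8, 7, 9, 8, 7, 0, 0, 0]
    [0, 3, 1, 2, 6, 4, 5, 8, 9, 7]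
    [7, 1, 4, 8, 2, 5, 9, 0, 3, 6] := by
  decide +kernel

/-- The order in which the edges of `F10` are coloured. -/
def edgesF10 : List (ℕ × ℕ) :=
  [(6, 7), (1, 6), (2, 6), (1, 5), (1, 9), (0, 9), (0, 8), (5, 8), (2, 8), (3, 5)]

theorem colorSearchFrom_F10 : colorSearchFrom 7 0 3 edgesF10 = true := by
  decide +kernel

theorem isSixValentCounterexample_F10 : (arcGraph 2 F10).IsSixValentCounterexample :=
  isArcTransitiveTable_F10.isSixValentCounterexample_of_search
    (fun i => ⟨petersenPairs i, petersenPairs_mem i⟩)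
    ((Fintype.bijective_iff_injective_and_card _).2 
      ⟨by decide +kernel, by decide +kernel⟩)
    -- The vertex 4 is on no edge of the list, so no cycle of listed edges is spanning.
    (by decide +kernel) (z := 4) (by norm_num) (by norm_num) (by decide +kernel)
    (by decide +kernel) colorSearchFrom_F10

/-- The neighbours of the vertices of `F16`. -/
def tableF16 : List (List ℕ) :=
  [[1, 2, 14], [0, 7, 11], [0, 3, 4], [2, 9, 13], [2, 5, 6], [4, 11, 15], [4, 7, 8], [1, 6, 13],
  [6, 9, 10], [3, 8, 15], [8, 11, 12], [1, 5, 10], [10, 13, 14], [3, 7, 12], [0, 12, 15], [5, 9,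
  14]]

theorem isArcTransitiveTable_F16 : IsArcTransitiveTable 16 tableF16
    [0, 0, 0, 2, 2, 11, 7, 1, 6, 3, 11, 1, 14, 7, 0, 14]
    [0, 2, 14, 12, 15, 5, 9, 3, 8, 10, 6, 4, 7, 13, 1, 11]
    [1, 0, 7, 6, 13, 12, 3, 2, 9, 8, 15, 14, 5, 4, 11, 10] := by
  decide +kernel

theorem isSixValentCounterexample_F16 : (arcGraph 2 F16).IsSixValentCounterexample :=
  isArcTransitiveTable_F16.isSixValentCounterexample_of_even
    (fun i => petersenLabel 8 i)
    ((Fintype.bijective_iff_injective_and_card _).2 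
      ⟨by decide +kernel, by decide +kernel⟩)
    -- In `GP(n, k)` with `n` even and `k` odd, every edge changes the parity of the position plus
    -- the rim bit.
    (by decide +kernel) (fun i => (i / 2 + i).testBit 0) (by decide +kernel) (m := 4)
    (by norm_num) (by decide +kernel)

/-- The neighbours of the vertices of `F18`. -/
def tableF18 : List (List ℕ) :=
  [[1, 3, 7], [0, 4, 12], [3, 5, 9], [0, 2, 14], [1, 5, 11], [2, 4, 16], [7, 9, 13], [0, 6, 10],
  [9, 11, 15], [2, 6, 8], [7, 11, 17], [4, 8, 10], [1, 13, 15], [6, 12, 16], [3, 15, 17], [8, 12,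
  14], [5, 13, 17], [10, 14, 16]]

theorem isArcTransitiveTable_F18 : IsArcTransitiveTable 18 tableF18
    [0, 0, 3, 0, 1, 4, 7, 0, 11, 2, 7, 4, 1, 12, 3, 12, 5, 14]
    [0, 3, 6, 7, 2, 9, 12, 1, 16, 13, 4, 5, 14, 15, 10, 17, 8, 11]
    [1, 0, 5, 4, 3, 2, 13, 12, 17, 16, 15, 14, 7, 6, 11, 10, 9, 8] := by
  decide +kernel

/-- The order in which the edges of `F18` are coloured. -/
def edgesF18 : List (ℕ × ℕ) :=
  [(1, 4), (4, 11), (4, 5), (8, 11), (10, 11), (8, 9), (8, 15), (12, 15), (14, 15), (12, 13), (6,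
  13), (13, 16), (6, 9), (2, 9), (5, 16), (2, 5), (2, 3), (16, 17), (14, 17), (3, 14), (0, 3),
  (10, 17)]

theorem colorSearchFrom_F18 : colorSearchFrom 1 0 12 edgesF18 = true := by
  decide +kernel

/-- The bipartition classes have 9 vertices, so the sign argument gives nothing and the search is
used. -/
theorem isSixValentCounterexample_F18 : (arcGraph 2 F18).IsSixValentCounterexample :=
  isArcTransitiveTable_F18.isSixValentCounterexample_of_search
    (fun i => torusLabel 3 i)
    ((Fintype.bijective_iff_injective_and_card _).2 
      ⟨by decide +kernel, by decide +kernel⟩)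
    (by decide +kernel) (z := 7) (by norm_num) (by norm_num) (by decide +kernel)
    (by decide +kernel) colorSearchFrom_F18

/-- The neighbours of the vertices of `F20B`. -/
def tableF20B : List (List ℕ) :=
  [[1, 2, 18], [0, 7, 15], [0, 3, 4], [2, 9, 17], [2, 5, 6], [4, 11, 19], [4, 7, 8], [1, 6, 13],
  [6, 9, 10], [3, 8, 15], [8, 11, 12], [5, 10, 17], [10, 13, 14], [7, 12, 19], [12, 15, 16], [1,
  9, 14], [14, 17, 18], [3, 11, 16], [0, 16, 19], [5, 13, 18]]

theorem isArcTransitiveTable_F20B : IsArcTransitiveTable 20 tableF20B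
    [0, 0, 0, 2, 2, 4, 7, 1, 6, 15, 8, 17, 13, 7, 15, 1, 18, 3, 0, 18]
    [0, 2, 18, 19, 16, 14, 17, 3, 11, 5, 10, 12, 8, 9, 6, 4, 7, 13, 1, 15]
    [1, 0, 7, 13, 6, 8, 4, 2, 5, 19, 11, 10, 17, 3, 16, 18, 14, 12, 15, 9] := by
  decide +kernel

theorem isSixValentCounterexample_F20B : (arcGraph 2 F20B).IsSixValentCounterexample :=
  isArcTransitiveTable_F20B.isSixValentCounterexample_of_even
    (fun i => petersenLabel 10 i)
    ((Fintype.bijective_iff_injective_and_card _).2 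
      ⟨by decide +kernel, by decide +kernel⟩)
    (by decide +kernel) (fun i => (i / 2 + i).testBit 0) (by decide +kernel) (m := 5)
    (by norm_num) (by decide +kernel)

/-- The neighbours of the vertices of `F24`. -/
def tableF24 : List (List ℕ) :=
  [[1, 2, 22], [0, 11, 15], [0, 3, 4], [2, 13, 17], [2, 5, 6], [4, 15, 19], [4, 7, 8], [6, 17,
  21], [6, 9, 10], [8, 19, 23], [8, 11, 12], [1, 10, 21], [10, 13, 14], [3, 12, 23], [12, 15, 16],
  [1, 5, 14], [14, 17, 18], [3, 7, 16], [16, 19, 20], [5, 9, 18], [18, 21, 22], [7, 11, 20], [0,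
  20, 23], [9, 13, 22]]

theorem isArcTransitiveTable_F24 : IsArcTransitiveTable 24 tableF24
    [0, 0, 0, 2, 2, 15, 4, 21, 10, 23, 11, 1, 10, 3, 15, 1, 14, 3, 20, 5, 22, 11, 0, 22]
    [0, 2, 22, 20, 23, 13, 9, 19, 8, 10, 6, 4, 7, 21, 17, 3, 16, 18, 14, 12, 15, 5, 1, 11]
    [1, 0, 11, 10, 21, 20, 7, 6, 17, 16, 3, 2, 13, 12, 23, 22, 9, 8, 19, 18, 5, 4, 15, 14] := by
  decide +kernel

theorem isSixValentCounterexample_F24 : (arcGraph 2 F24).IsSixValentCounterexample :=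
  isArcTransitiveTable_F24.isSixValentCounterexample_of_even
    (fun i => petersenLabel 12 i)
    ((Fintype.bijective_iff_injective_and_card _).2 
      ⟨by decide +kernel, by decide +kernel⟩)
    (by decide +kernel) (fun i => (i / 2 + i).testBit 0) (by decide +kernel) (m := 6)
    (by norm_num) (by decide +kernel)

/-- The neighbours of the vertices of `F28`. -/
def tableF28 : List (List ℕ) :=
  [[25, 26, 27], [21, 24, 26], [20, 21, 23], [20, 22, 25], [18, 19, 27], [16, 17, 26], [15, 17,
  19], [13, 14, 24], [14, 19, 23], [13, 18, 22], [12, 13, 16], [12, 15, 20], [10, 11, 27], [7, 9,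
  10], [7, 8, 25], [6, 11, 24], [5, 10, 23], [5, 6, 22], [4, 9, 21], [4, 6, 8], [2, 3, 11], [1, 2,
  18], [3, 9, 17], [2, 8, 16], [1, 7, 15], [0, 3, 14], [0, 1, 5], [0, 4, 12]]

theorem isArcTransitiveTable_F28 : IsArcTransitiveTable 28 tableF28
    [0, 26, 20, 25, 27, 26, 17, 14, 14, 22, 12, 12, 27, 7, 25, 24, 5, 5, 4, 4, 3, 1, 3, 8, 1, 0,
    0, 0]
    [0, 12, 15, 1, 3, 4, 9, 16, 17, 2, 8, 7, 14, 23, 5, 13, 19, 18, 20, 22, 24, 11, 21, 6, 10, 26,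
    27, 25]
    [25, 20, 21, 26, 8, 22, 6, 12, 4, 16, 13, 24, 7, 10, 27, 15, 9, 17, 23, 19, 1, 2, 5, 18, 11,
    0, 3, 14] := by
  decide +kernel

/-- The order in which the edges of `F28` are coloured. -/
def edgesF28 : List (ℕ × ℕ) :=
  [(0, 27), (1, 26), (5, 26), (12, 27), (4, 27), (10, 12), (11, 12), (10, 16), (10, 13), (5, 16),
  (16, 23), (5, 17), (11, 20), (11, 15), (6, 15), (15, 24), (1, 24), (7, 24), (1, 21), (6, 17),
  (6, 19), (17, 22), (4, 19), (8, 19), (4, 18), (8, 23), (2, 23), (2, 20), (2, 21), (18, 21), (9,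
  18), (3, 20), (3, 22), (3, 25), (9, 22), (9, 13), (7, 13)]

theorem colorSearchFrom_F28 : colorSearchFrom 0 25 26 edgesF28 = true := by
  decide +kernel

/-- The Coxeter graph contains 7-cycles, so it is not bipartite and the sign argument does not
apply. -/
theorem isSixValentCounterexample_F28 : (arcGraph 2 F28).IsSixValentCounterexample :=
  isArcTransitiveTable_F28.isSixValentCounterexample_of_search
    (fun i => ⟨coxeterTriples i, coxeterTriples_mem i⟩)
    ((Fintype.bijective_iff_injective_and_card _).2 
      ⟨by decide +kernel, by decide +kernel⟩)
    (by decide +kernel) (z := 14) (by norm_num) (by norm_num) (by decide +kernel)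
    (by decide +kernel) colorSearchFrom_F28

/-- The neighbours of the vertices of `F30`. -/
def tableF30 : List (List ℕ) :=
  [[15, 16, 17], [18, 19, 20], [21, 22, 23], [24, 25, 26], [27, 28, 29], [21, 24, 27], [18, 25,
  28], [19, 22, 29], [20, 23, 26], [15, 26, 29], [16, 23, 28], [17, 22, 25], [17, 20, 27], [16,
  19, 24], [15, 18, 21], [0, 9, 14], [0, 10, 13], [0, 11, 12], [1, 6, 14], [1, 7, 13], [1, 8, 12],
  [2, 5, 14], [2, 7, 11], [2, 8, 10], [3, 5, 13], [3, 6, 11], [3, 8, 9], [4, 5, 12], [4, 6, 10],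
  [4, 7, 9]]

theorem isArcTransitiveTable_F30 : IsArcTransitiveTable 30 tableF30
    [0, 18, 21, 26, 29, 21, 18, 29, 26, 15, 16, 17, 17, 16, 15, 0, 0, 0, 14, 13, 12, 14, 11, 10,
    13, 11, 9, 12, 10, 9]
    [0, 5, 7, 8, 6, 1, 3, 4, 2, 10, 11, 9, 14, 12, 13, 16, 17, 15, 24, 27, 21, 19, 29, 22, 20, 26,
    23, 18, 25, 28]
    [15, 22, 20, 28, 24, 27, 25, 19, 23, 16, 26, 18, 21, 29, 17, 0, 9, 14, 11, 7, 2, 12, 1, 8, 4,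
    6, 10, 5, 3, 13] := by
  decide +kernel

/-- The order in which the edges of `F30` are coloured. -/
def edgesF30 : List (ℕ × ℕ) :=
  [(0, 17), (13, 16), (10, 16), (13, 24), (13, 19), (5, 24), (3, 24), (3, 26), (3, 25), (12, 17),
  (11, 17), (11, 25), (11, 22), (6, 25), (7, 22), (2, 22), (7, 19), (7, 29), (1, 19), (4, 29), (9,
  29), (9, 15), (9, 26), (8, 26), (14, 15), (14, 18), (6, 18), (1, 18), (1, 20), (6, 28), (12,
  20), (8, 20), (8, 23), (12, 27), (2, 23), (10, 23), (10, 28), (4, 28), (4, 27), (5, 27)]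

theorem colorSearchFrom_F30 : colorSearchFrom 0 15 16 edgesF30 = true := by
  decide +kernel

theorem isSixValentCounterexample_F30 : (arcGraph 2 F30).IsSixValentCounterexample :=
  isArcTransitiveTable_F30.isSixValentCounterexample_of_search
    (tutteCoxeterLabel)
    bijective_tutteCoxeterLabel
    (by decide +kernel) (z := 21) (by norm_num) (by norm_num) (by decide +kernel)
    (by decide +kernel) colorSearchFrom_F30

/-- The neighbours of the vertices of `F32`. -/
def tableF32 : List (List ℕ) :=
  [[1, 3, 9], [0, 6, 24], [3, 5, 11], [0, 2, 26], [5, 7, 13], [2, 4, 28], [1, 7, 15], [4, 6, 30],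
  [9, 11, 17], [0, 8, 14], [11, 13, 19], [2, 8, 10], [13, 15, 21], [4, 10, 12], [9, 15, 23], [6,
  12, 14], [17, 19, 25], [8, 16, 22], [19, 21, 27], [10, 16, 18], [21, 23, 29], [12, 18, 20], [17,
  23, 31], [14, 20, 22], [1, 25, 27], [16, 24, 30], [3, 27, 29], [18, 24, 26], [5, 29, 31], [20,
  26, 28], [7, 25, 31], [22, 28, 30]]

theorem isArcTransitiveTable_F32 : IsArcTransitiveTable 32 tableF32
    [0, 0, 3, 0, 7, 2, 1, 6, 9, 0, 11, 2, 15, 4, 9, 6, 25, 8, 27, 16, 29, 12, 17, 14, 1, 24, 3,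
    24, 5, 26, 7, 30]
    [0, 3, 14, 9, 20, 23, 26, 29, 6, 1, 12, 15, 18, 21, 24, 27, 4, 7, 10, 13, 16, 19, 30, 25, 2,
    5, 8, 11, 22, 17, 28, 31]
    [1, 0, 7, 6, 5, 4, 3, 2, 25, 24, 31, 30, 29, 28, 27, 26, 17, 16, 23, 22, 21, 20, 19, 18, 9, 8,
    15, 14, 13, 12, 11, 10] := by
  decide +kernel

theorem isSixValentCounterexample_F32 : (arcGraph 2 F32).IsSixValentCounterexample :=
  isArcTransitiveTable_F32.isSixValentCounterexample_of_even
    (fun i => torusLabel 4 i)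
    ((Fintype.bijective_iff_injective_and_card _).2 
      ⟨by decide +kernel, by decide +kernel⟩)
    -- The lowest bit of the label is the class of the vertex in the hexagonal torus.
    (by decide +kernel) (fun i => i.testBit 0) (by decide +kernel) (m := 8)
    (by norm_num) (by decide +kernel)

/-- The neighbours of the vertices of `F40`. -/
def tableF40 : List (List ℕ) :=
  [[21, 22, 38], [20, 25, 37], [20, 23, 24], [22, 27, 39], [22, 25, 26], [21, 24, 29], [24, 27,
  28], [23, 26, 31], [26, 29, 30], [25, 28, 33], [28, 31, 32], [27, 30, 35], [30, 33, 34], [29,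
  32, 37], [32, 35, 36], [31, 34, 39], [34, 37, 38], [21, 33, 36], [20, 36, 39], [23, 35, 38], [1,
  2, 18], [0, 5, 17], [0, 3, 4], [2, 7, 19], [2, 5, 6], [1, 4, 9], [4, 7, 8], [3, 6, 11], [6, 9,
  10], [5, 8, 13], [8, 11, 12], [7, 10, 15], [10, 13, 14], [9, 12, 17], [12, 15, 16], [11, 14,
  19], [14, 17, 18], [1, 13, 16], [0, 16, 19], [3, 15, 18]]

theorem isArcTransitiveTable_F40 : IsArcTransitiveTable 40 tableF40
    [0, 25, 24, 22, 22, 21, 24, 26, 29, 33, 28, 27, 33, 29, 36, 39, 38, 21, 36, 38, 2, 0, 0, 19,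
    5, 4, 4, 3, 6, 5, 8, 15, 13, 17, 16, 19, 17, 16, 0, 3]
    [0, 2, 18, 16, 19, 3, 15, 14, 11, 7, 10, 12, 8, 6, 9, 13, 5, 4, 1, 17, 20, 22, 38, 36, 39, 23,
    35, 34, 31, 27, 30, 32, 28, 26, 29, 33, 25, 24, 21, 37]
    [21, 20, 25, 29, 24, 22, 26, 28, 27, 23, 31, 30, 35, 39, 34, 32, 36, 38, 37, 33, 1, 0, 5, 9,
    4, 2, 6, 8, 7, 3, 11, 10, 15, 19, 14, 12, 16, 18, 17, 13] := by
  decide +kernel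

theorem isSixValentCounterexample_F40 : (arcGraph 2 F40).IsSixValentCounterexample :=
  isArcTransitiveTable_F40.isSixValentCounterexample_of_even
    -- The labels below 20 form one sheet of the double cover and the others the second; the sheets
    -- are the two classes.
    (fun i => if i.1 < 20 then Sum.inl (petersenLabel 10 i) else Sum.inr (petersenLabel 10 (i - 20)))
    ((Fintype.bijective_iff_injective_and_card _).2 
      ⟨by decide +kernel, by decide +kernel⟩)
    (by decide +kernel) (fun i => decide (20 ≤ i)) (by decide +kernel) (m := 10)
    (by norm_num) (by decide +kernel)

/-- The neighbours of the vertices of `F48`. -/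
def tableF48 : List (List ℕ) :=
  [[1, 2, 46], [0, 11, 39], [0, 3, 4], [2, 13, 41], [2, 5, 6], [4, 15, 43], [4, 7, 8], [6, 17,
  45], [6, 9, 10], [8, 19, 47], [8, 11, 12], [1, 10, 21], [10, 13, 14], [3, 12, 23], [12, 15, 16],
  [5, 14, 25], [14, 17, 18], [7, 16, 27], [16, 19, 20], [9, 18, 29], [18, 21, 22], [11, 20, 31],
  [20, 23, 24], [13, 22, 33], [22, 25, 26], [15, 24, 35], [24, 27, 28], [17, 26, 37], [26, 29,
  30], [19, 28, 39], [28, 31, 32], [21, 30, 41], [30, 33, 34], [23, 32, 43], [32, 35, 36], [25,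
  34, 45], [34, 37, 38], [27, 36, 47], [36, 39, 40], [1, 29, 38], [38, 41, 42], [3, 31, 40], [40,
  43, 44], [5, 33, 42], [42, 45, 46], [7, 35, 44], [0, 44, 47], [9, 37, 46]]

theorem isArcTransitiveTable_F48 : IsArcTransitiveTable 48 tableF48
    [0, 0, 0, 2, 2, 4, 4, 6, 10, 47, 11, 1, 10, 3, 12, 5, 14, 7, 20, 29, 21, 11, 20, 13, 22, 15,
    28, 37, 29, 39, 31, 21, 30, 23, 36, 45, 38, 47, 39, 1, 38, 3, 44, 5, 46, 44, 0, 46]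
    [0, 2, 46, 44, 47, 37, 9, 19, 8, 10, 6, 4, 7, 45, 17, 27, 16, 18, 14, 12, 15, 5, 25, 35, 24,
    26, 22, 20, 23, 13, 33, 43, 32, 34, 30, 28, 31, 21, 41, 3, 40, 42, 38, 36, 39, 29, 1, 11]
    [1, 0, 11, 10, 21, 20, 31, 30, 41, 40, 3, 2, 13, 12, 23, 22, 33, 32, 43, 42, 5, 4, 15, 14, 25,
    24, 35, 34, 45, 44, 7, 6, 17, 16, 27, 26, 37, 36, 47, 46, 9, 8, 19, 18, 29, 28, 39, 38] := by
  decide +kernel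

theorem isSixValentCounterexample_F48 : (arcGraph 2 F48).IsSixValentCounterexample :=
  isArcTransitiveTable_F48.isSixValentCounterexample_of_even
    (fun i => petersenLabel 24 i)
    ((Fintype.bijective_iff_injective_and_card _).2 
      ⟨by decide +kernel, by decide +kernel⟩)
    (by decide +kernel) (fun i => (i / 2 + i).testBit 0) (by decide +kernel) (m := 12)
    (by norm_num) (by decide +kernel)

/-- The neighbours of the vertices of `F50`. -/
def tableF50 : List (List ℕ) :=
  [[1, 3, 11], [0, 8, 40], [3, 5, 13], [0, 2, 42], [5, 7, 15], [2, 4, 44], [7, 9, 17], [4, 6, 46],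
  [1, 9, 19], [6, 8, 48], [11, 13, 21], [0, 10, 18], [13, 15, 23], [2, 10, 12], [15, 17, 25], [4,
  12, 14], [17, 19, 27], [6, 14, 16], [11, 19, 29], [8, 16, 18], [21, 23, 31], [10, 20, 28], [23,
  25, 33], [12, 20, 22], [25, 27, 35], [14, 22, 24], [27, 29, 37], [16, 24, 26], [21, 29, 39],
  [18, 26, 28], [31, 33, 41], [20, 30, 38], [33, 35, 43], [22, 30, 32], [35, 37, 45], [24, 32,
  34], [37, 39, 47], [26, 34, 36], [31, 39, 49], [28, 36, 38], [1, 41, 43], [30, 40, 48], [3, 43,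
  45], [32, 40, 42], [5, 45, 47], [34, 42, 44], [7, 47, 49], [36, 44, 46], [9, 41, 49], [38, 46,
  48]]

theorem isArcTransitiveTable_F50 : IsArcTransitiveTable 50 tableF50
    [0, 0, 3, 0, 5, 2, 9, 6, 1, 8, 11, 0, 13, 2, 17, 4, 19, 6, 11, 8, 21, 10, 33, 12, 27, 14, 29,
    16, 21, 18, 41, 30, 43, 30, 45, 32, 47, 34, 49, 28, 1, 40, 3, 40, 5, 42, 7, 44, 9, 48]
    [0, 3, 18, 11, 26, 29, 34, 37, 42, 45, 8, 1, 16, 19, 24, 27, 32, 35, 40, 43, 6, 9, 14, 17, 22,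
    25, 30, 33, 48, 41, 4, 7, 12, 15, 20, 23, 38, 31, 46, 49, 2, 5, 10, 13, 28, 21, 36, 39, 44,
    47]
    [1, 0, 9, 8, 7, 6, 5, 4, 3, 2, 41, 40, 49, 48, 47, 46, 45, 44, 43, 42, 31, 30, 39, 38, 37, 36,
    35, 34, 33, 32, 21, 20, 29, 28, 27, 26, 25, 24, 23, 22, 11, 10, 19, 18, 17, 16, 15, 14, 13,
    12] := by
  decide +kernel

/-- The order in which the edges of `F50` are coloured. -/
def edgesF50 : List (ℕ × ℕ) :=
  [(1, 8), (8, 19), (8, 9), (40, 41), (40, 43), (6, 9), (9, 48), (41, 48), (30, 41), (48, 49),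
  (30, 33), (30, 31), (31, 38), (20, 31), (38, 49), (46, 49), (38, 39), (36, 39), (28, 39), (28,
  29), (21, 28), (20, 21), (10, 21), (20, 23), (10, 11), (10, 13), (0, 11), (11, 18), (0, 3), (18,
  29), (18, 19), (26, 29), (16, 19), (16, 27), (16, 17), (6, 17), (6, 7), (14, 17), (7, 46), (4,
  7), (46, 47), (36, 47), (44, 47), (36, 37), (26, 37), (26, 27), (24, 27), (34, 37), (44, 45),
  (5, 44), (34, 45), (42, 45), (3, 42), (42, 43), (2, 3), (32, 43), (4, 5), (2, 5), (2, 13), (12,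
  13), (4, 15), (14, 15), (12, 15), (12, 23), (22, 23), (14, 25), (24, 25), (22, 25), (22, 33),
  (32, 33)]

theorem colorSearchFrom_F50 : colorSearchFrom 1 0 40 edgesF50 = true := by
  decide +kernel

/-- The classes have 25 vertices, an odd number, so this torus again needs the search, unlike `F32`.
-/
theorem isSixValentCounterexample_F50 : (arcGraph 2 F50).IsSixValentCounterexample :=
  isArcTransitiveTable_F50.isSixValentCounterexample_of_search
    (fun i => torusLabel 5 i)
    ((Fintype.bijective_iff_injective_and_card _).2 
      ⟨by decide +kernel, by decide +kernel⟩)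
    (by decide +kernel) (z := 35) (by norm_num) (by norm_num) (by decide +kernel)
    (by decide +kernel) colorSearchFrom_F50

end Examples

end SimpleGraph

theorem proposition2 :
    (SimpleGraph.arcGraph 2 SimpleGraph.F8).IsSixValentCounterexample ∧
    (SimpleGraph.arcGraph 2 SimpleGraph.F10).IsSixValentCounterexample ∧
    (SimpleGraph.arcGraph 2 SimpleGraph.F16).IsSixValentCounterexample ∧
    (SimpleGraph.arcGraph 2 SimpleGraph.F18).IsSixValentCounterexample ∧
    (SimpleGraph.arcGraph 2 SimpleGraph.F20B).IsSixValentCounterexample ∧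
    (SimpleGraph.arcGraph 2 SimpleGraph.F24).IsSixValentCounterexample ∧
    (SimpleGraph.arcGraph 2 SimpleGraph.F28).IsSixValentCounterexample ∧
    (SimpleGraph.arcGraph 2 SimpleGraph.F30).IsSixValentCounterexample ∧
    (SimpleGraph.arcGraph 2 SimpleGraph.F32).IsSixValentCounterexample ∧
    (SimpleGraph.arcGraph 2 SimpleGraph.F40).IsSixValentCounterexample ∧
    (SimpleGraph.arcGraph 2 SimpleGraph.F48).IsSixValentCounterexample ∧
    (SimpleGraph.arcGraph 2 SimpleGraph.F50).IsSixValentCounterexample := by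
  exact ⟨SimpleGraph.isSixValentCounterexample_F8, SimpleGraph.isSixValentCounterexample_F10,
    SimpleGraph.isSixValentCounterexample_F16, SimpleGraph.isSixValentCounterexample_F18,
    SimpleGraph.isSixValentCounterexample_F20B, SimpleGraph.isSixValentCounterexample_F24,
    SimpleGraph.isSixValentCounterexample_F28, SimpleGraph.isSixValentCounterexample_F30,
    SimpleGraph.isSixValentCounterexample_F32, SimpleGraph.isSixValentCounterexample_F40,
    SimpleGraph.isSixValentCounterexample_F48, SimpleGraph.isSixValentCounterexample_F50⟩
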